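/- Corollary 1.3. A domain (nonempty connected open set) $D\subset\mathbb{R}^3$ is called minimally convex if it admits a smooth exhaustion function $\rho\colon D\to\mathbb{R}$ (that is, $\{x\in D:\rho(x)\le c\}$ is compact for every $c\in\mathbb{R}$) which is strongly $2$-plurisubharmonic, meaning that for every $x\in D$ the trace of the Hessian of $\rho$ at $x$ on every $2$-dimensional linear subspace of $\mathbb{R}^3$ is positive (equivalently, the sum of the two smallest eigenvalues of the Hessian is positive). An embedded minimal surface is a smooth embedded surface without boundary whose mean curvature vanishes identically. (1) If $S$ is a properly embedded minimal surface in $\mathbb{R}^3$ (an embedded minimal surface which is a closed subset of $\mathbb{R}^3$), then every connected component of $\mathbb{R}^3\setminus S$ is a minimally convex domain. (2) More generally, if $D\subset\mathbb{R}^3$ is a minimally convex domain, $U\subset\mathbb{R}^3$ is an open set containing the closure $\overline D$, and $S\subset U$ is an embedded minimal surface which is closed in $U$, then every connected component of $D\setminus S$ is a minimally convex domain. -/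

import Mathlib

open scoped ContDiff

noncomputable section

/-- Euclidean space `ℝⁿ`. -/
abbrev Euc (n : ℕ) : Type := EuclideanSpace ℝ (Fin n)

/-- The Hessian of `u` at `x` as a bilinear form: `∑ ∂²u/∂xⱼ∂xₖ (x) vⱼ wₖ`. -/
def hess {n : ℕ} (u : Euc n → ℝ) (x v w : Euc n) : ℝ :=
  fderiv ℝ (fderiv ℝ u) x v w

/-- `u` is strongly `p`-plurisubharmonic on the open set `D ⊆ ℝⁿ`: it is of class `C²` there and
the trace of its Hessian on every `p`-dimensional linear subspace, computed in an arbitrary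
orthonormal basis `e` of the subspace, is positive at every point of `D`. -/
def StronglyPlurisubharmonicOn {n : ℕ} (p : ℕ) (u : Euc n → ℝ) (D : Set (Euc n)) : Prop :=
  ContDiffOn ℝ 2 u D ∧
    ∀ x ∈ D, ∀ e : Fin p → Euc n, Orthonormal ℝ e → 0 < ∑ i, hess u x (e i) (e i)

/-- `ρ` is an exhaustion function on `D`: its sublevel sets in `D` are compact. -/
def IsExhaustionOn {n : ℕ} (ρ : Euc n → ℝ) (D : Set (Euc n)) : Prop :=
  ∀ c : ℝ, IsCompact {x | x ∈ D ∧ ρ x ≤ c}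

/-- A domain (nonempty connected open set) `D ⊆ ℝⁿ` is minimally convex if it admits a smooth
strongly `2`-plurisubharmonic exhaustion function. -/
def MinimallyConvex {n : ℕ} (D : Set (Euc n)) : Prop :=
  IsOpen D ∧ IsConnected D ∧
    ∃ ρ : Euc n → ℝ,
      ContDiffOn ℝ ∞ ρ D ∧ StronglyPlurisubharmonicOn 2 ρ D ∧ IsExhaustionOn ρ D

/-- `r` is a smooth local defining function, on the open set `V`, of the set `S ⊆ ℝ³`. -/
structure IsLocalDefiningFunction (S V : Set (Euc 3)) (r : Euc 3 → ℝ) : Prop where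
  isOpen : IsOpen V
  smooth : ContDiffOn ℝ ∞ r V
  zeroSet : S ∩ V = {x | x ∈ V ∧ r x = 0}
  gradient_ne_zero : ∀ x ∈ S ∩ V, gradient r x ≠ 0

/-- The unit normal field (Gauss map) of the level sets of `r`. -/
def unitNormal (r : Euc 3 → ℝ) (x : Euc 3) : Euc 3 :=
  ‖gradient r x‖⁻¹ • gradient r x

/-- The tangent plane at `x` of the level set of `r` through `x`. -/
def tangentPlane (r : Euc 3 → ℝ) (x : Euc 3) : Submodule ℝ (Euc 3) :=
  (Submodule.span ℝ {gradient r x})ᗮ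

/-- The shape operator `v ↦ -dN(v)` of the level set of `r` at `x`, on the tangent plane; `N` is
the unit normal. (As `N` has constant length, `dN(v)` is tangent, so that the projection only
serves to record the codomain.) -/
def shapeOperator (r : Euc 3 → ℝ) (x : Euc 3) : tangentPlane r x →ₗ[ℝ] tangentPlane r x :=
  -((tangentPlane r x).orthogonalProjectionOnto.toLinearMap ∘ₗ
      (fderiv ℝ (unitNormal r) x).toLinearMap ∘ₗ (tangentPlane r x).subtype)

/-- The mean curvature of the level set of `r` at `x`: half the trace of the shape operator, that
is, half the sum of the two principal curvatures. -/
def meanCurvature (r : Euc 3 → ℝ) (x : Euc 3) : ℝ :=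
  (1 / 2) * LinearMap.trace ℝ (tangentPlane r x) (shapeOperator r x)

/-- `S ⊆ ℝ³` is a smooth embedded surface (without boundary) all of whose mean curvatures vanish. -/
def IsEmbeddedMinimalSurface (S : Set (Euc 3)) : Prop :=
  ∀ p ∈ S, ∃ (V : Set (Euc 3)) (r : Euc 3 → ℝ), p ∈ V ∧ IsLocalDefiningFunction S V r ∧
    ∀ x ∈ S ∩ V, meanCurvature r x = 0

/-- `C` is a connected component of the set `A`. -/
def IsComponentOf {n : ℕ} (C A : Set (Euc n)) : Prop :=
  ∃ x ∈ A, C = connectedComponentIn A x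

end

/-! The exhaustion function of a component is `ψ ∘ ρ - log h`. Here `ρ` is the exhaustion function
of the ambient domain, `ψ` is convex and increases fast on the range of `ρ`, and `h` is a sum of
squares of local defining functions of the surface `S`, glued by a partition of unity. The term
`-log h` blows up at `S`; the point is that its Hessian traces on planes stay locally bounded below
up to `S`, so that `ψ ∘ ρ` can absorb them.

For one defining function `r`, the trace of the Hessian of `-log r²` on the plane spanned by an
orthonormal pair `e` is `-2 tr(Hess r)/r + 2 ∑ (dr(eᵢ)/r)²`. Vanishing mean curvature makes `Hess r`
trace-free on tangent planes at `S`, hence `|tr(Hess r)| ≤ C (|r| + ∑ |dr(eᵢ)|)` near `S`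
(`exists_abs_sum_hess_le`). With `σ = ∑ |dr(eᵢ)| / |r|`, the bad term is at most linear in `σ` and
the good one is at least `σ²`, so the sum is bounded below.

To glue, write `h = r² g` near a point, where `g` is a sum of terms `f (q/r)²` with `q` another
defining function. Smoothness of `q/r` across `S` is not needed: its Hessian traces are also `O(1 +
σ)` (`IsLocalDefiningFunction.isModerateAt_div`), and such linear errors are again absorbed by `σ²`
(`IsModerateAt.exists_le_sum_hess_neg_log`). The case of `ℝ³` follows by taking `ρ = ‖x‖²`. -/

open scoped ContDiff
open Filter Topology

/-! ### Sum, product and chain rules for the Hessian. -/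

section HessianCalculus

variable {n : ℕ}

theorem ContDiffAt.differentiableAt_fderiv {u : Euc n → ℝ} {x : Euc n} (hu : ContDiffAt ℝ 2 u x) :
    DifferentiableAt ℝ (fderiv ℝ u) x :=
  (hu.fderiv_right (m := 1) (by norm_num)).differentiableAt (by norm_num)

theorem ContDiffAt.eventually_differentiableAt {u : Euc n → ℝ} {x : Euc n}
    (hu : ContDiffAt ℝ 2 u x) : ∀ᶠ y in 𝓝 x, DifferentiableAt ℝ u y :=
  (hu.eventually (by simp)).mono fun _ hy => hy.differentiableAt (by norm_num)

theorem hess_congr {u v : Euc n → ℝ} {x : Euc n} (h : u =ᶠ[𝓝 x] v) (a b : Euc n) :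
    hess u x a b = hess v x a b := by
  unfold hess
  rw [h.fderiv.fderiv_eq]

theorem hess_add {u v : Euc n → ℝ} {x : Euc n} (hu : ContDiffAt ℝ 2 u x)
    (hv : ContDiffAt ℝ 2 v x) (a b : Euc n) :
    hess (fun y => u y + v y) x a b = hess u x a b + hess v x a b := by
  have h : fderiv ℝ (fun y => u y + v y) =ᶠ[𝓝 x] fun y => fderiv ℝ u y + fderiv ℝ v y := by
    filter_upwards [hu.eventually_differentiableAt, hv.eventually_differentiableAt] with y h1 h2
    exact fderiv_fun_add h1 h2
  unfold hess
  rw [h.fderiv_eq, fderiv_fun_add hu.differentiableAt_fderiv hv.differentiableAt_fderiv]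
  simp

theorem hess_mul {u v : Euc n → ℝ} {x : Euc n} (hu : ContDiffAt ℝ 2 u x)
    (hv : ContDiffAt ℝ 2 v x) (a : Euc n) :
    hess (fun y => u y * v y) x a a =
      u x * hess v x a a + v x * hess u x a a + 2 * (fderiv ℝ u x a * fderiv ℝ v x a) := by
  have h : fderiv ℝ (fun y => u y * v y) =ᶠ[𝓝 x]
      fun y => u y • fderiv ℝ v y + v y • fderiv ℝ u y := by
    filter_upwards [hu.eventually_differentiableAt, hv.eventually_differentiableAt] with y h1 h2
    exact fderiv_fun_mul h1 h2
  have hu1 := hu.differentiableAt (by norm_num)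
  have hv1 := hv.differentiableAt (by norm_num)
  unfold hess
  rw [h.fderiv_eq, fderiv_fun_add (hu1.fun_smul hv.differentiableAt_fderiv)
    (hv1.fun_smul hu.differentiableAt_fderiv), fderiv_fun_smul hu1 hv.differentiableAt_fderiv,
    fderiv_fun_smul hv1 hu.differentiableAt_fderiv]
  simp
  ring

theorem hess_comp {f : ℝ → ℝ} {u : Euc n → ℝ} {x : Euc n} (hf : ContDiffAt ℝ 2 f (u x))
    (hu : ContDiffAt ℝ 2 u x) (a : Euc n) :
    hess (fun y => f (u y)) x a a =
      deriv f (u x) * hess u x a a + deriv (deriv f) (u x) * fderiv ℝ u x a ^ 2 := by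
  have hu1 := hu.differentiableAt (by norm_num)
  have hf2 : DifferentiableAt ℝ (deriv f) (u x) :=
    ((hf.fderiv_right (m := 1) (by norm_num)).differentiableAt (by norm_num)).clm_apply
      (differentiableAt_const 1)
  have h : fderiv ℝ (fun y => f (u y)) =ᶠ[𝓝 x] fun y => deriv f (u y) • fderiv ℝ u y := by
    have hfe : ∀ᶠ t in 𝓝 (u x), DifferentiableAt ℝ f t :=
      (hf.eventually (by simp)).mono fun _ hy => hy.differentiableAt (by norm_num)
    filter_upwards [hu.eventually_differentiableAt, hu1.continuousAt.eventually hfe] with y h1 h2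
    exact (h2.hasDerivAt.comp_hasFDerivAt y h1.hasFDerivAt).fderiv
  have h2 := (hf2.hasDerivAt.comp_hasFDerivAt x hu1.hasFDerivAt)
  have h3 : HasFDerivAt (fun y => deriv f (u y)) (deriv (deriv f) (u x) • fderiv ℝ u x) x := h2
  unfold hess
  rw [h.fderiv_eq, (h3.fun_smul hu.differentiableAt_fderiv.hasFDerivAt).fderiv]
  simp
  ring

theorem hess_const_mul {u : Euc n → ℝ} {x : Euc n} (c : ℝ) (hu : ContDiffAt ℝ 2 u x) (a : Euc n) :
    hess (fun y => c * u y) x a a = c * hess u x a a := by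
  rw [hess_comp (f := fun t => c * t) (by fun_prop) hu]
  have : deriv (fun t : ℝ => c * t) = fun _ => c := by
    ext t; simp
  rw [this]
  simp

/-- In `-log u` the squared term becomes positive; it is the source of all positivity near the
surface. -/
theorem hess_log {u : Euc n → ℝ} {x : Euc n} (hu : ContDiffAt ℝ 2 u x) (h0 : u x ≠ 0)
    (a : Euc n) :
    hess (fun y => Real.log (u y)) x a a = hess u x a a / u x - (fderiv ℝ u x a / u x) ^ 2 := by
  rw [hess_comp (Real.contDiffAt_log.2 h0) hu, Real.deriv_log']
  simp
  field_simp
  ring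

theorem abs_hess_le (u : Euc n → ℝ) (x a b : Euc n) :
    |hess u x a b| ≤ ‖fderiv ℝ (fderiv ℝ u) x‖ * ‖a‖ * ‖b‖ :=
  (fderiv ℝ (fderiv ℝ u) x).le_opNorm₂ a b

end HessianCalculus

/-! ### Traces on planes and vanishing mean curvature. -/

section PlaneTraces

theorem OrthonormalBasis.sum_bilin_eq {ι κ E : Type*} [Fintype ι] [Fintype κ]
    [NormedAddCommGroup E] [InnerProductSpace ℝ E] (b : OrthonormalBasis ι ℝ E)
    (c : OrthonormalBasis κ ℝ E) (B : E →L[ℝ] E →L[ℝ] ℝ) :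
    ∑ i, B (b i) (b i) = ∑ j, B (c j) (c j) := by
  classical
  have h (i : ι) : B (b i) (b i) = ∑ j, inner ℝ (c j) (b i) * B (b i) (c j) := by
    conv_lhs => enter [2]; rw [← c.sum_repr' (b i)]
    simp
  have h' (j : κ) : B (c j) (c j) = ∑ i, inner ℝ (b i) (c j) * B (b i) (c j) := by
    conv_lhs => enter [1]; rw [← b.sum_repr' (c j)]
    simp
  simp_rw [h, h']
  rw [Finset.sum_comm]
  simp_rw [real_inner_comm]

theorem exists_orthonormalBasis_extending_pair {e : Fin 2 → Euc 3} (he : Orthonormal ℝ e) :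
    ∃ b : OrthonormalBasis (Fin 3) ℝ (Euc 3), b 0 = e 0 ∧ b 1 = e 1 := by
  have hon : Orthonormal ℝ (({0, 1} : Set (Fin 3)).domRestrict ![e 0, e 1, 0]) := by
    rw [orthonormal_iff_ite] at he ⊢
    have h00 := he 0 0
    have h01 := he 0 1
    have h10 := he 1 0
    have h11 := he 1 1
    rintro ⟨i, hi⟩ ⟨j, hj⟩
    rcases hi with rfl | rfl <;> rcases hj with rfl | rfl <;> simp_all [Set.domRestrict, Subtype.ext_iff]
  obtain ⟨b, hb⟩ := hon.exists_orthonormalBasis_extension_of_card_eq (by simp)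
  exact ⟨b, by simpa using hb 0 (by simp), by simpa using hb 1 (by simp)⟩

theorem exists_orthonormalBasis_extending_unit {v : Euc 3} (hv : ‖v‖ = 1) :
    ∃ b : OrthonormalBasis (Fin 3) ℝ (Euc 3), b 2 = v := by
  have hon : Orthonormal ℝ (({2} : Set (Fin 3)).domRestrict ![0, 0, v]) := by
    rw [orthonormal_iff_ite]
    rintro ⟨i, hi⟩ ⟨j, hj⟩
    rcases hi with rfl
    rcases hj with rfl
    simp [Set.domRestrict, hv]
  obtain ⟨b, hb⟩ := hon.exists_orthonormalBasis_extension_of_card_eq (by simp)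
  exact ⟨b, by simpa using hb 2 (by simp)⟩

/-- If the trace of `B` on the orthogonal complement of the unit vector `N` vanishes, then its trace
on a plane is controlled by the angle between the two planes. -/
theorem abs_sum_bilin_le_of_trace_eq_zero {B : Euc 3 →L[ℝ] Euc 3 →L[ℝ] ℝ} {N : Euc 3}
    (hN : ‖N‖ = 1)
    (hB : ∀ e : Fin 2 → Euc 3, Orthonormal ℝ e → (∀ i, inner ℝ N (e i) = 0) →
      ∑ i, B (e i) (e i) = 0)
    {e : Fin 2 → Euc 3} (he : Orthonormal ℝ e) :
    |∑ i, B (e i) (e i)| ≤ 3 * ‖B‖ * ∑ i, |inner ℝ N (e i)| := by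
  obtain ⟨b, hb2⟩ := exists_orthonormalBasis_extending_unit hN
  obtain ⟨c, hc0, hc1⟩ := exists_orthonormalBasis_extending_pair he
  have hb := b.orthonormal
  have htan : B (b 0) (b 0) + B (b 1) (b 1) = 0 := by
    have := hB (b ∘ Fin.castSucc) (hb.comp _ (Fin.castSucc_injective 2)) (fun i => by
      rw [← hb2]
      apply hb.2
      fin_cases i <;> decide)
    simpa [Fin.sum_univ_two] using this
  have htr := b.sum_bilin_eq c B
  rw [Fin.sum_univ_three, Fin.sum_univ_three, hb2, hc0, hc1] at htr
  set m := c 2 with hm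
  have hm1 : ‖m‖ = 1 := c.orthonormal.1 2
  have hNexp := c.sum_repr' N
  rw [Fin.sum_univ_three, hc0, hc1, ← hm] at hNexp
  have hnorm := c.sum_sq_norm_inner_right N
  rw [Fin.sum_univ_three, hc0, hc1, ← hm, hN] at hnorm
  simp only [Real.norm_eq_abs, sq_abs, one_pow] at hnorm
  rw [Fin.sum_univ_two, Fin.sum_univ_two, real_inner_comm, real_inner_comm (e 1)]
  set a0 := inner ℝ (e 0) N
  set a1 := inner ℝ (e 1) N
  set a2 := inner ℝ m N
  set w := a0 • e 0 + a1 • e 1 with hw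
  have hwN : N = w + a2 • m := hNexp.symm
  have hwn : ‖w‖ ≤ |a0| + |a1| := by
    refine (norm_add_le _ _).trans ?_
    rw [norm_smul, norm_smul, he.1 0, he.1 1]
    simp
  have ha2 : |a2| ≤ 1 := by
    rw [← sq_le_one_iff_abs_le_one]; nlinarith
  have ha0 : |a0| ≤ 1 := by
    rw [← sq_le_one_iff_abs_le_one]; nlinarith
  have ha1 : |a1| ≤ 1 := by
    rw [← sq_le_one_iff_abs_le_one]; nlinarith
  -- The full trace of `B` is `B N N` in the basis adapted to `N`, so the trace on the plane with
  -- unit normal `m` is `B N N - B m m`. Expanding `N = w + a2 • m` with `a2² = 1 - a0² - a1²`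
  -- leaves only terms containing `a0` or `a1`.
  have key : B (e 0) (e 0) + B (e 1) (e 1) =
      B w N + a2 * B m w - (a0 ^ 2 + a1 ^ 2) * B m m := by
    have h1 : B N N = B w N + a2 * B m w + a2 ^ 2 * B m m := by
      conv_lhs => enter [1]; rw [hwN]
      simp only [map_add, map_smul, FunLike.coe_add, FunLike.coe_smul, Pi.add_apply, Pi.smul_apply,
        smul_eq_mul, add_assoc]
      congr 1
      conv_lhs => rw [hwN]
      simp only [map_add, map_smul, smul_eq_mul]
      ring
    linear_combination htan - htr + h1 + B m m * hnorm
  have hB1 : |B w N| ≤ ‖B‖ * (|a0| + |a1|) := by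
    refine (B.le_opNorm₂ w N).trans ?_
    rw [hN, mul_one]
    gcongr
  have hB2 : |a2 * B m w| ≤ ‖B‖ * (|a0| + |a1|) := by
    rw [abs_mul]
    have : |B m w| ≤ ‖B‖ * (|a0| + |a1|) := by
      refine (B.le_opNorm₂ m w).trans ?_
      rw [hm1, mul_one]
      gcongr
    calc _ ≤ 1 * (‖B‖ * (|a0| + |a1|)) := by gcongr
      _ = _ := one_mul _
  have hB3 : |(a0 ^ 2 + a1 ^ 2) * B m m| ≤ ‖B‖ * (|a0| + |a1|) := by
    rw [abs_mul]
    have h3 : |B m m| ≤ ‖B‖ := by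
      refine (B.le_opNorm₂ m m).trans ?_
      rw [hm1]; simp
    have h4 : |a0 ^ 2 + a1 ^ 2| ≤ |a0| + |a1| := by
      rw [abs_of_nonneg (by positivity), ← sq_abs a0, ← sq_abs a1]
      nlinarith [abs_nonneg a0, abs_nonneg a1]
    rw [mul_comm]
    gcongr
  rw [key]
  calc _ ≤ |B w N + a2 * B m w| + |(a0 ^ 2 + a1 ^ 2) * B m m| := abs_sub _ _
    _ ≤ |B w N| + |a2 * B m w| + |(a0 ^ 2 + a1 ^ 2) * B m m| := by gcongr; exact abs_add_le _ _
    _ ≤ _ := by linarith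

theorem inner_gradient_eq {r : Euc 3 → ℝ} (x v : Euc 3) :
    inner ℝ (gradient r x) v = fderiv ℝ r x v := by
  simp [gradient]

theorem ContDiffAt.differentiableAt_gradient {r : Euc 3 → ℝ} {x : Euc 3}
    (hr : ContDiffAt ℝ 2 r x) : DifferentiableAt ℝ (gradient r) x :=
  ((InnerProductSpace.toDual ℝ (Euc 3)).symm.toContinuousLinearEquiv.differentiableAt).comp x
    hr.differentiableAt_fderiv

/-- On a level set with vanishing mean curvature the Hessian of the defining function is trace-free
on the tangent plane. -/
theorem sum_hess_eq_zero_of_meanCurvature_eq_zero {r : Euc 3 → ℝ} {x : Euc 3}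
    (hr : ContDiffAt ℝ 2 r x) (h0 : gradient r x ≠ 0) (hH : meanCurvature r x = 0)
    {e : Fin 2 → Euc 3} (he : Orthonormal ℝ e) (het : ∀ i, fderiv ℝ r x (e i) = 0) :
    ∑ i, hess r x (e i) (e i) = 0 := by
  have hmem (i) : e i ∈ tangentPlane r x := by
    rw [tangentPlane, Submodule.mem_orthogonal_singleton_iff_inner_right, inner_gradient_eq, het]
  have hfin : Module.finrank ℝ (tangentPlane r x) = 2 := by
    have := Submodule.finrank_add_finrank_orthogonal (Submodule.span ℝ {gradient r x})
    rw [finrank_span_singleton h0] at this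
    simp only [finrank_euclideanSpace, Fintype.card_fin] at this
    rw [tangentPlane]
    omega
  let e' : Fin 2 → tangentPlane r x := fun i => ⟨e i, hmem i⟩
  have he' : Orthonormal ℝ e' := by
    rw [orthonormal_iff_ite] at he ⊢
    exact he
  let b : OrthonormalBasis (Fin 2) ℝ (tangentPlane r x) :=
    (basisOfOrthonormalOfCardEqFinrank he' (by simp [hfin])).toOrthonormalBasis (by simpa using he')
  have hb (i) : b i = e' i := by simp [b]
  have hg := hr.differentiableAt_gradient
  have hN : DifferentiableAt ℝ (unitNormal r) x :=
    ((hg.norm ℝ h0).inv (norm_ne_zero_iff.2 h0)).smul hg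
  -- Differentiate `⟪eᵢ, N⟫ = ‖∇r‖⁻¹ dr(eᵢ)`: the derivative of the factor `‖∇r‖⁻¹` drops out
  -- because `dr(eᵢ) = 0` at `x`.
  have hder (v : Euc 3) (i) : inner ℝ (e i) (fderiv ℝ (unitNormal r) x v) =
      ‖gradient r x‖⁻¹ * hess r x v (e i) := by
    have h1 : fderiv ℝ (fun y => inner ℝ (e i) (unitNormal r y)) x v =
        inner ℝ (e i) (fderiv ℝ (unitNormal r) x v) := by
      rw [fderiv_inner_apply ℝ (differentiableAt_const _) hN]
      simp
    have h2 : (fun y => inner ℝ (e i) (unitNormal r y)) =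
        fun y => ‖gradient r y‖⁻¹ * fderiv ℝ r y (e i) := by
      ext y
      rw [unitNormal, inner_smul_right, real_inner_comm, inner_gradient_eq]
    rw [← h1, h2, fderiv_fun_mul ((hg.norm ℝ h0).fun_inv (norm_ne_zero_iff.2 h0))
      (hr.differentiableAt_fderiv.clm_apply (differentiableAt_const _)),
      fderiv_clm_apply hr.differentiableAt_fderiv (differentiableAt_const _)]
    simp [het, hess]
  rw [meanCurvature, LinearMap.trace_eq_sum_inner _ b] at hH
  have hsum : ∑ i, inner ℝ (b i) (shapeOperator r x (b i)) =
      -(‖gradient r x‖⁻¹ * ∑ i, hess r x (e i) (e i)) := by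
    rw [Finset.mul_sum, ← Finset.sum_neg_distrib]
    refine Finset.sum_congr rfl fun i _ => ?_
    rw [hb, ← hder]
    simp [shapeOperator, e']
  rw [hsum] at hH
  have := norm_ne_zero_iff.2 h0
  simpa [this] using hH

end PlaneTraces

/-! ### Estimates near the zero set of a defining function. -/

section LocalEstimates

theorem ContinuousAt.exists_eventually_norm_le {X F : Type*} [TopologicalSpace X]
    [NormedAddCommGroup F] {f : X → F} {p : X} (hf : ContinuousAt f p) :
    ∃ M, 0 < M ∧ ∀ᶠ x in 𝓝 p, ‖f x‖ ≤ M :=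
  ⟨‖f p‖ + 1, by positivity, hf.norm.eventually_le_const (lt_add_one _)⟩

theorem ContDiffAt.exists_eventually_norm_sub_le {F : Type*} [NormedAddCommGroup F]
    [NormedSpace ℝ F] {f : Euc 3 → F} {p : Euc 3} (hf : ContDiffAt ℝ 1 f p) :
    ∃ K, 0 ≤ K ∧ ∃ δ > 0, ∀ x ∈ Metric.ball p δ, ∀ y ∈ Metric.ball p δ,
      ‖f x - f y‖ ≤ K * ‖x - y‖ := by
  obtain ⟨K, t, ht, hK⟩ := hf.exists_lipschitzOnWith
  obtain ⟨δ, hδ, hball⟩ := Metric.mem_nhds_iff.1 ht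
  exact ⟨K, K.2, δ, hδ, fun x hx y hy => hK.norm_sub_le (hball hx) (hball hy)⟩

/-- Near a regular zero `p` of `r`, the distance to the zero set is bounded by a multiple
of `|r|`. -/
theorem exists_zero_norm_sub_le {r : Euc 3 → ℝ} {p : Euc 3} (hr : ContDiffAt ℝ 1 r p)
    (h0 : fderiv ℝ r p ≠ 0) (hp : r p = 0) :
    ∃ C, 0 < C ∧ ∀ W ∈ 𝓝 p, ∀ᶠ x in 𝓝 p, ∃ y ∈ W, r y = 0 ∧ ‖x - y‖ ≤ C * |r x| := by
  have hsurj : (fderiv ℝ r p).range = ⊤ :=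
    LinearMap.range_eq_top.2 (LinearMap.surjective (f := (fderiv ℝ r p : Euc 3 →ₗ[ℝ] ℝ))
      (fun h => h0 (ContinuousLinearMap.coe_injective h)))
  set f' := fderiv ℝ r p
  let f's := f'.nonlinearRightInverseOfSurjective hsurj
  have hpos : 0 < f's.nnnorm := f'.nonlinearRightInverseOfSurjective_nnnorm_pos hsurj
  have hstrict : HasStrictFDerivAt r f' p := hr.hasStrictFDerivAt one_ne_zero
  -- Let `κ` be the norm of the right inverse. With approximation constant `κ⁻¹ / 2`, the image of a
  -- ball of radius `ε` contains the ball of radius `ε / (2κ)` about the image of the centre; it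
  -- contains `0` once `ε = 2κ |r x|`.
  obtain ⟨s, hs, happ⟩ := hstrict.approximates_deriv_on_nhds (c := f's.nnnorm⁻¹ / 2)
    (Or.inr (by positivity))
  have hposR : (0 : ℝ) < f's.nnnorm := hpos
  refine ⟨2 * f's.nnnorm, by positivity, fun W hW => ?_⟩
  obtain ⟨δ, hδ, hball⟩ := Metric.mem_nhds_iff.1 (inter_mem hs hW)
  have hlim : Tendsto (fun x => dist x p + 2 * f's.nnnorm * |r x|) (𝓝 p) (𝓝 0) := by
    have h1 : ContinuousAt (fun x => dist x p + 2 * f's.nnnorm * |r x|) p := by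
      have := hr.continuousAt
      fun_prop
    simpa [ContinuousAt, hp] using h1
  filter_upwards [hlim.eventually_lt_const hδ] with x hx
  have hsub : Metric.closedBall x (2 * f's.nnnorm * |r x|) ⊆ s ∩ W := by
    refine Set.Subset.trans (fun y hy => ?_) hball
    rw [Metric.mem_closedBall] at hy
    rw [Metric.mem_ball]
    linarith [dist_triangle y x p]
  obtain ⟨y, hy, hy0⟩ := happ.surjOn_closedBall_of_nonlinearRightInverse f's
    (ε := 2 * f's.nnnorm * |r x|) (by positivity) (fun y hy => (hsub hy).1)
    (show (0 : ℝ) ∈ _ by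
      rw [Metric.mem_closedBall, dist_comm, Real.dist_eq, sub_zero]
      push_cast
      field_simp
      norm_num)
  refine ⟨y, (hsub hy).2, hy0, ?_⟩
  rw [← dist_eq_norm, dist_comm]
  exact hy

variable {S V : Set (Euc 3)} {r : Euc 3 → ℝ}

theorem IsLocalDefiningFunction.contDiffAt (h : IsLocalDefiningFunction S V r) {p : Euc 3}
    (hp : p ∈ V) {n : ℕ} : ContDiffAt ℝ n r p :=
  (h.smooth.contDiffAt (h.isOpen.mem_nhds hp)).of_le (by exact_mod_cast le_top)

theorem IsLocalDefiningFunction.eq_zero_iff (h : IsLocalDefiningFunction S V r) {p : Euc 3}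
    (hp : p ∈ V) : r p = 0 ↔ p ∈ S := by
  have := Set.ext_iff.1 h.zeroSet p
  simp only [Set.mem_inter_iff, hp, and_true, Set.mem_ofPred_eq, true_and] at this
  exact this.symm

theorem IsLocalDefiningFunction.fderiv_ne_zero (h : IsLocalDefiningFunction S V r) {p : Euc 3}
    (hp : p ∈ V) (hp0 : r p = 0) : fderiv ℝ r p ≠ 0 := fun h' =>
  h.gradient_ne_zero p ⟨(h.eq_zero_iff hp).1 hp0, hp⟩ (by simp [gradient, h'])

theorem norm_gradient (r : Euc 3 → ℝ) (x : Euc 3) : ‖gradient r x‖ = ‖fderiv ℝ r x‖ := by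
  simp [gradient]

theorem abs_sum_hess_le_of_norm_le {u : Euc 3 → ℝ} {x : Euc 3} {M : ℝ}
    (hM : ‖fderiv ℝ (fderiv ℝ u) x‖ ≤ M) {e : Fin 2 → Euc 3} (he : Orthonormal ℝ e) :
    |∑ i, hess u x (e i) (e i)| ≤ 2 * M := by
  rw [Fin.sum_univ_two]
  have h (i) : |hess u x (e i) (e i)| ≤ M := by
    have := abs_hess_le u x (e i) (e i)
    rw [he.1 i] at this
    linarith
  linarith [abs_add_le (hess u x (e 0) (e 0)) (hess u x (e 1) (e 1)), h 0, h 1]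

/-- On the zero set of a minimal defining function, the trace of the Hessian on a plane is
controlled by the angle of the plane with the tangent plane. -/
theorem abs_sum_hess_mul_norm_le {y : Euc 3} (hr : ContDiffAt ℝ 2 r y)
    (h0 : gradient r y ≠ 0) (hH : meanCurvature r y = 0)
    {e : Fin 2 → Euc 3} (he : Orthonormal ℝ e) :
    |∑ i, hess r y (e i) (e i)| * ‖fderiv ℝ r y‖ ≤
      3 * ‖fderiv ℝ (fderiv ℝ r) y‖ * ∑ i, |fderiv ℝ r y (e i)| := by
  have hn := norm_pos_iff.2 h0
  have hN : ‖unitNormal r y‖ = 1 := by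
    rw [unitNormal, norm_smul, norm_inv, norm_norm, inv_mul_cancel₀ hn.ne']
  have hin (v) : inner ℝ (unitNormal r y) v = ‖gradient r y‖⁻¹ * fderiv ℝ r y v := by
    rw [unitNormal, real_inner_smul_left, inner_gradient_eq]
  have := abs_sum_bilin_le_of_trace_eq_zero (B := fderiv ℝ (fderiv ℝ r) y) hN
    (fun e he hte => sum_hess_eq_zero_of_meanCurvature_eq_zero hr h0 hH he (fun i => by
      have := hte i
      rw [hin] at this
      simpa [hn.ne'] using this)) he
  simp_rw [hin, abs_mul, abs_inv, abs_norm, ← Finset.mul_sum] at this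
  rw [← norm_gradient]
  calc _ ≤ 3 * ‖fderiv ℝ (fderiv ℝ r) y‖ * (‖gradient r y‖⁻¹ * ∑ i, |fderiv ℝ r y (e i)|)
          * ‖gradient r y‖ := by gcongr; exact this
    _ = _ := by field_simp

/-- Near a zero of `r`, the estimate on the zero set is carried from a zero `y` with `‖x - y‖ ≤ C |r
x|` to `x`, the first two derivatives of `r` being Lipschitz; the error is `O(|r x|)`. Away from the
zero set `|r|` is bounded below, and boundedness of the Hessian is enough. -/
theorem exists_abs_sum_hess_le (hr : IsLocalDefiningFunction S V r)
    (hmin : ∀ x ∈ S ∩ V, meanCurvature r x = 0) {p : Euc 3} (hp : p ∈ V) :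
    ∃ C, 0 ≤ C ∧ ∀ᶠ x in 𝓝 p, ∀ e : Fin 2 → Euc 3, Orthonormal ℝ e →
      |∑ i, hess r x (e i) (e i)| ≤ C * (|r x| + ∑ i, |fderiv ℝ r x (e i)|) := by
  have hr3 : ContDiffAt ℝ 3 r p := hr.contDiffAt hp
  have hd1 : ContDiffAt ℝ 2 (fderiv ℝ r) p := hr3.fderiv_right (by norm_num)
  have hd2 : ContDiffAt ℝ 1 (fderiv ℝ (fderiv ℝ r)) p := hd1.fderiv_right (by norm_num)
  obtain ⟨M, hM, hMev⟩ := hd2.continuousAt.exists_eventually_norm_le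
  by_cases h0 : r p = 0
  · obtain ⟨C, hC, hproj⟩ := exists_zero_norm_sub_le (hr.contDiffAt (n := 1) hp)
      (hr.fderiv_ne_zero hp h0) h0
    obtain ⟨K1, hK1, δ1, hδ1, hL1⟩ :=
      (hd1.of_le (by norm_num : (1 : WithTop ℕ∞) ≤ 2)).exists_eventually_norm_sub_le
    obtain ⟨K2, hK2, δ2, hδ2, hL2⟩ := hd2.exists_eventually_norm_sub_le
    have hc0 := norm_pos_iff.2 (hr.fderiv_ne_zero hp h0)
    set c := ‖fderiv ℝ r p‖ / 2 with hc
    have hcpos : 0 < c := by positivity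
    have hcev : ∀ᶠ y in 𝓝 p, c ≤ ‖fderiv ℝ r y‖ :=
      hd1.continuousAt.norm.eventually_const_le (by rw [hc]; linarith)
    have hW := (((hcev.and hMev).and (hr.isOpen.mem_nhds hp)).and (Metric.ball_mem_nhds p hδ1)).and
      (Metric.ball_mem_nhds p hδ2)
    refine ⟨2 * K2 * C + 3 * M / c * (2 * K1 * C) + 3 * M / c, by positivity, ?_⟩
    filter_upwards [hproj _ hW, Metric.ball_mem_nhds p hδ1, Metric.ball_mem_nhds p hδ2] with
      x ⟨y, ⟨⟨⟨⟨hcy, hMy⟩, hyV⟩, hy1⟩, hy2⟩, hy0, hxy⟩ hx1 hx2 e he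
    have hyS : y ∈ S := (hr.eq_zero_iff hyV).1 hy0
    have hT := abs_sum_hess_mul_norm_le (hr.contDiffAt (n := 2) hyV)
      (hr.gradient_ne_zero y ⟨hyS, hyV⟩) (hmin y ⟨hyS, hyV⟩) he
    have hdiff (i) : |fderiv ℝ r y (e i)| ≤ |fderiv ℝ r x (e i)| + K1 * C * |r x| := by
      have h1 := (fderiv ℝ r x - fderiv ℝ r y).le_opNorm (e i)
      rw [he.1 i, mul_one, Real.norm_eq_abs, FunLike.coe_sub, Pi.sub_apply, abs_sub_comm] at h1
      have h2 : K1 * ‖x - y‖ ≤ K1 * (C * |r x|) := by gcongr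
      have h3 := abs_sub_abs_le_abs_sub (fderiv ℝ r y (e i)) (fderiv ℝ r x (e i))
      linarith [hL1 x hx1 y hy1]
    have hhess (i) : |hess r x (e i) (e i) - hess r y (e i) (e i)| ≤ K2 * C * |r x| := by
      have h1 := (fderiv ℝ (fderiv ℝ r) x - fderiv ℝ (fderiv ℝ r) y).le_opNorm₂ (e i) (e i)
      rw [he.1 i, mul_one, mul_one, Real.norm_eq_abs] at h1
      have h2 : K2 * ‖x - y‖ ≤ K2 * (C * |r x|) := by gcongr
      have h3 : hess r x (e i) (e i) - hess r y (e i) (e i) =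
        (fderiv ℝ (fderiv ℝ r) x - fderiv ℝ (fderiv ℝ r) y) (e i) (e i) := rfl
      rw [h3]
      linarith [hL2 x hx2 y hy2]
    have hTy : |∑ i, hess r y (e i) (e i)| ≤ 3 * M / c * ∑ i, |fderiv ℝ r y (e i)| := by
      rw [div_mul_eq_mul_div, le_div_iff₀ hcpos]
      calc _ ≤ |∑ i, hess r y (e i) (e i)| * ‖fderiv ℝ r y‖ := by gcongr
        _ ≤ _ := hT
        _ ≤ _ := by gcongr
    have hsx : 0 ≤ ∑ i, |fderiv ℝ r x (e i)| := by positivity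
    have hsum : ∑ i, |fderiv ℝ r y (e i)| ≤
        ∑ i, |fderiv ℝ r x (e i)| + 2 * (K1 * C * |r x|) := by
      simp only [Fin.sum_univ_two]
      linarith [hdiff 0, hdiff 1]
    have hTx : |∑ i, hess r x (e i) (e i)| ≤
        |∑ i, hess r y (e i) (e i)| + 2 * (K2 * C * |r x|) := by
      simp only [Fin.sum_univ_two]
      have h0 := abs_le.1 (hhess 0)
      have h1 := abs_le.1 (hhess 1)
      have h2 := abs_le.1 (le_refl |hess r y (e 0) (e 0) + hess r y (e 1) (e 1)|)
      rw [abs_le]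
      constructor <;> linarith
    have hm := mul_le_mul_of_nonneg_left hsum (show 0 ≤ 3 * M / c by positivity)
    have h5 : 0 ≤ (2 * K2 * C + 3 * M / c * (2 * K1 * C)) * ∑ i, |fderiv ℝ r x (e i)| := by
      positivity
    have h6 : 0 ≤ 3 * M / c * |r x| := by positivity
    linarith
  · have hc := abs_pos.2 h0
    have hcev : ∀ᶠ x in 𝓝 p, |r p| / 2 ≤ |r x| :=
      hr3.continuousAt.abs.eventually_const_le (by linarith)
    refine ⟨2 * M / (|r p| / 2), by positivity, ?_⟩
    filter_upwards [hMev, hcev] with x hx hx2 e he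
    refine (abs_sum_hess_le_of_norm_le hx he).trans ?_
    rw [div_mul_eq_mul_div, le_div_iff₀ (by positivity)]
    have : 0 ≤ ∑ i, |fderiv ℝ r x (e i)| := by positivity
    have := mul_le_mul_of_nonneg_left (hx2.trans (le_add_of_nonneg_right this))
      (show 0 ≤ 2 * M by positivity)
    linarith

end LocalEstimates

/-! ### Moderate functions and the lower bound for `-log (r² g)`. -/

section ModerateFunctions

/-- `g` is moderate along `{r = 0}` at `p`: near `p` and off `{r = 0}` it is of class `C²`, it and
its differential are bounded, and the trace of its Hessian on the plane spanned by an orthonormal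
pair `e` is bounded by a multiple of `1 + ∑ |dr(eᵢ)| / |r|`. -/
def IsModerateAt (r : Euc 3 → ℝ) (p : Euc 3) (g : Euc 3 → ℝ) : Prop :=
  ∃ C, 0 ≤ C ∧ ∀ᶠ x in 𝓝 p, r x ≠ 0 → ContDiffAt ℝ 2 g x ∧ |g x| ≤ C ∧
    (∀ v, |fderiv ℝ g x v| ≤ C * ‖v‖) ∧ ∀ e : Fin 2 → Euc 3, Orthonormal ℝ e →
      |∑ i, hess g x (e i) (e i)| * |r x| ≤ C * (|r x| + ∑ i, |fderiv ℝ r x (e i)|)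

variable {r : Euc 3 → ℝ} {p : Euc 3}

theorem ContDiffAt.isModerateAt {g : Euc 3 → ℝ} (hg : ContDiffAt ℝ 2 g p) :
    IsModerateAt r p g := by
  have hd1 : ContDiffAt ℝ 1 (fderiv ℝ g) p := hg.fderiv_right (by norm_num)
  have hd2 : ContDiffAt ℝ 0 (fderiv ℝ (fderiv ℝ g)) p := hd1.fderiv_right (by norm_num)
  obtain ⟨M0, h0, h0ev⟩ := hg.continuousAt.exists_eventually_norm_le
  obtain ⟨M1, h1, h1ev⟩ := hd1.continuousAt.exists_eventually_norm_le
  obtain ⟨M2, h2, h2ev⟩ := hd2.continuousAt.exists_eventually_norm_le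
  refine ⟨M0 + M1 + 2 * M2, by positivity, ?_⟩
  filter_upwards [h0ev, h1ev, h2ev, hg.eventually (by simp)] with x hx0 hx1 hx2 hx _
  refine ⟨hx, ?_, fun v => ?_, fun e he => ?_⟩
  · rw [Real.norm_eq_abs] at hx0
    linarith
  · refine ((fderiv ℝ g x).le_opNorm v).trans ?_
    gcongr
    linarith
  · have := abs_sum_hess_le_of_norm_le hx2 he
    have hs : 0 ≤ ∑ i, |fderiv ℝ r x (e i)| := by positivity
    gcongr
    · linarith
    · linarith

theorem IsModerateAt.add {f g : Euc 3 → ℝ} (hf : IsModerateAt r p f) (hg : IsModerateAt r p g) :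
    IsModerateAt r p (fun x => f x + g x) := by
  obtain ⟨A, hA, hfA⟩ := hf
  obtain ⟨B, hB, hgB⟩ := hg
  refine ⟨A + B, by positivity, ?_⟩
  filter_upwards [hfA, hgB] with x hfx hgx hrx
  obtain ⟨f1, f2, f3, f4⟩ := hfx hrx
  obtain ⟨g1, g2, g3, g4⟩ := hgx hrx
  refine ⟨f1.add g1, ?_, fun v => ?_, fun e he => ?_⟩
  · exact (abs_add_le _ _).trans (add_le_add f2 g2)
  · rw [fderiv_fun_add (f1.differentiableAt (by norm_num)) (g1.differentiableAt (by norm_num)),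
      FunLike.coe_add, Pi.add_apply]
    linarith [abs_add_le (fderiv ℝ f x v) (fderiv ℝ g x v), f3 v, g3 v]
  · simp only [hess_add f1 g1, Finset.sum_add_distrib]
    have := mul_le_mul_of_nonneg_right (abs_add_le (∑ i, hess f x (e i) (e i))
      (∑ i, hess g x (e i) (e i))) (abs_nonneg (r x))
    linarith [f4 e he, g4 e he]

/-- The cross term of the Hessian of a product is harmless because both differentials are bounded.
-/
theorem IsModerateAt.mul {f g : Euc 3 → ℝ} (hf : IsModerateAt r p f) (hg : IsModerateAt r p g) :
    IsModerateAt r p (fun x => f x * g x) := by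
  obtain ⟨A, hA, hfA⟩ := hf
  obtain ⟨B, hB, hgB⟩ := hg
  refine ⟨6 * (A * B), by positivity, ?_⟩
  filter_upwards [hfA, hgB] with x hfx hgx hrx
  obtain ⟨f1, f2, f3, f4⟩ := hfx hrx
  obtain ⟨g1, g2, g3, g4⟩ := hgx hrx
  have hAB : 0 ≤ A * B := by positivity
  refine ⟨f1.mul g1, ?_, fun v => ?_, fun e he => ?_⟩
  · rw [abs_mul]
    have : |f x| * |g x| ≤ A * B := by gcongr
    linarith
  · rw [fderiv_fun_mul (f1.differentiableAt (by norm_num)) (g1.differentiableAt (by norm_num))]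
    simp only [FunLike.coe_add, FunLike.coe_smul, Pi.add_apply, Pi.smul_apply, smul_eq_mul]
    have h1 : |f x * fderiv ℝ g x v| ≤ A * (B * ‖v‖) := by
      rw [abs_mul]; gcongr; exact g3 v
    have h2 : |g x * fderiv ℝ f x v| ≤ B * (A * ‖v‖) := by
      rw [abs_mul]; gcongr; exact f3 v
    have h3 : 0 ≤ A * B * ‖v‖ := by positivity
    linarith [abs_add_le (f x * fderiv ℝ g x v) (g x * fderiv ℝ f x v)]
  · simp only [hess_mul f1 g1, Finset.sum_add_distrib, ← Finset.mul_sum]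
    set F := ∑ i, hess f x (e i) (e i)
    set G := ∑ i, hess g x (e i) (e i)
    set s := ∑ i, |fderiv ℝ r x (e i)|
    have hs : 0 ≤ s := by positivity
    have h1 : |f x * G| * |r x| ≤ A * (B * (|r x| + s)) := by
      rw [abs_mul, mul_assoc]
      exact mul_le_mul f2 (g4 e he) (by positivity) hA
    have h2 : |g x * F| * |r x| ≤ B * (A * (|r x| + s)) := by
      rw [abs_mul, mul_assoc]
      exact mul_le_mul g2 (f4 e he) (by positivity) hB
    have h3 : |∑ i, fderiv ℝ f x (e i) * fderiv ℝ g x (e i)| ≤ 2 * (A * B) := by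
      have h (i) : |fderiv ℝ f x (e i) * fderiv ℝ g x (e i)| ≤ A * B := by
        have hf := f3 (e i)
        have hg := g3 (e i)
        rw [he.1 i, mul_one] at hf hg
        rw [abs_mul]; gcongr
      rw [Fin.sum_univ_two]
      linarith [abs_add_le (fderiv ℝ f x (e 0) * fderiv ℝ g x (e 0))
        (fderiv ℝ f x (e 1) * fderiv ℝ g x (e 1)), h 0, h 1]
    have h4 : |2 * ∑ i, fderiv ℝ f x (e i) * fderiv ℝ g x (e i)| * |r x| ≤
        2 * (2 * (A * B)) * |r x| := by
      rw [abs_mul, abs_two]; gcongr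
    have h5 := mul_le_mul_of_nonneg_right (abs_add_three (f x * G) (g x * F)
      (2 * ∑ i, fderiv ℝ f x (e i) * fderiv ℝ g x (e i))) (abs_nonneg (r x))
    have h6 : 0 ≤ A * B * s := by positivity
    linarith

theorem IsModerateAt.sum {ι : Type*} {g : ι → Euc 3 → ℝ} (T : Finset ι)
    (hg : ∀ i ∈ T, IsModerateAt r p (g i)) : IsModerateAt r p (fun x => ∑ i ∈ T, g i x) := by
  classical
  induction T using Finset.induction_on with
  | empty => simpa using (contDiffAt_const (c := (0 : ℝ))).isModerateAt
  | insert i T hi ih =>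
    simp only [Finset.sum_insert hi]
    exact (hg i (by simp)).add (ih fun j hj => hg j (by simp [hj]))

/-- The negative logarithm of `r² g`, with `g` positive and moderate along the minimal surface
`{r = 0}`, has Hessian traces that are locally bounded below. -/
theorem IsModerateAt.exists_le_sum_hess_neg_log {g : Euc 3 → ℝ} (hg : IsModerateAt r p g)
    (hr : ContDiffAt ℝ 2 r p) {c : ℝ} (hc : 0 < c) (hcg : ∀ᶠ x in 𝓝 p, r x ≠ 0 → c ≤ g x)
    (htr : ∃ C, 0 ≤ C ∧ ∀ᶠ x in 𝓝 p, ∀ e : Fin 2 → Euc 3, Orthonormal ℝ e →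
      |∑ i, hess r x (e i) (e i)| ≤ C * (|r x| + ∑ i, |fderiv ℝ r x (e i)|)) :
    ∃ M, ∀ᶠ x in 𝓝 p, r x ≠ 0 → ∀ e : Fin 2 → Euc 3, Orthonormal ℝ e →
      -M ≤ ∑ i, hess (fun y => -Real.log (r y ^ 2 * g y)) x (e i) (e i) := by
  obtain ⟨A, hA, hgA⟩ := hg
  obtain ⟨B, hB, hrB⟩ := htr
  set K := 2 * B + A / c with hK
  refine ⟨K + K ^ 2 / 4, ?_⟩
  filter_upwards [hgA, hrB, hcg, hcg.eventually_nhds, hr.eventually (by simp)] with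
    x hgx hrx hcx hcx' hrx2 hx0 e he
  obtain ⟨g1, g2, g3, g4⟩ := hgx hx0
  have hgpos : 0 < g x := hc.trans_le (hcx hx0)
  have hr0 : ∀ᶠ y in 𝓝 x, r y ≠ 0 := hrx2.continuousAt.eventually_ne hx0
  -- `Real.log` is even, so `log (r²) = 2 log r` holds on both sides of the surface.
  have heq : (fun y => -Real.log (r y ^ 2 * g y)) =ᶠ[𝓝 x]
      fun y => (-2) * Real.log (r y) + (-1) * Real.log (g y) := by
    filter_upwards [hr0, hcx'] with y hy hy'
    rw [Real.log_mul (pow_ne_zero 2 hy) (hc.trans_le (hy' hy)).ne', Real.log_pow]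
    push_cast
    ring
  have hlr := hrx2.log hx0
  have hlg := g1.log hgpos.ne'
  have hess_eq (i) : hess (fun y => -Real.log (r y ^ 2 * g y)) x (e i) (e i) =
      (-2) * (hess r x (e i) (e i) / r x) + 2 * (fderiv ℝ r x (e i) / r x) ^ 2
        - hess g x (e i) (e i) / g x + (fderiv ℝ g x (e i) / g x) ^ 2 := by
    rw [hess_congr heq, hess_add (contDiffAt_const.mul hlr) (contDiffAt_const.mul hlg),
      hess_const_mul _ hlr, hess_const_mul _ hlg, hess_log hrx2 hx0, hess_log g1 hgpos.ne']
    ring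
  simp only [hess_eq, Finset.sum_add_distrib, Finset.sum_sub_distrib, ← Finset.mul_sum,
    ← Finset.sum_div]
  set R := ∑ i, hess r x (e i) (e i)
  set G := ∑ i, hess g x (e i) (e i)
  have habs : 0 < |r x| := abs_pos.2 hx0
  set s := ∑ i, |fderiv ℝ r x (e i)| with hs
  set σ := s / |r x| with hσ
  have hσ0 : 0 ≤ σ := by positivity
  have hfac : |r x| + s = (1 + σ) * |r x| := by rw [hσ]; field_simp
  have hR : R / r x ≤ B * (1 + σ) := by
    refine (le_abs_self _).trans ?_
    rw [abs_div, div_le_iff₀ habs, mul_assoc, ← hfac]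
    exact hrx e he
  have hG : G / g x ≤ A / c * (1 + σ) := by
    have h1 : |G| ≤ A * (1 + σ) := by
      have := g4 e he
      rw [hfac, ← mul_assoc] at this
      exact le_of_mul_le_mul_right this habs
    calc G / g x ≤ |G| / g x := by gcongr; exact le_abs_self _
      _ ≤ A * (1 + σ) / c := by gcongr; exact hcx hx0
      _ = _ := by ring
  -- By this bound the trace is at least `σ² - K (1 + σ) = (σ - K/2)² - K - K²/4`, which explains
  -- the constant `K + K²/4`.
  have hsq : σ ^ 2 ≤ 2 * ∑ i, (fderiv ℝ r x (e i) / r x) ^ 2 := by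
    rw [hσ, hs]
    simp only [Fin.sum_univ_two, div_pow]
    rw [sq_abs, ← add_div, mul_div_assoc']
    gcongr
    rw [← sq_abs (fderiv ℝ r x (e 0)), ← sq_abs (fderiv ℝ r x (e 1))]
    nlinarith [sq_nonneg (|fderiv ℝ r x (e 0)| - |fderiv ℝ r x (e 1)|)]
  have hg2 : 0 ≤ ∑ i, (fderiv ℝ g x (e i) / g x) ^ 2 := by positivity
  have hfinal : 0 ≤ (σ - K / 2) ^ 2 := sq_nonneg _
  have hKe : K * (1 + σ) = 2 * (B * (1 + σ)) + A / c * (1 + σ) := by rw [hK]; ring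
  nlinarith

end ModerateFunctions

/-! ### Quotients of two defining functions of the same surface. -/

section QuotientsOfDefiningFunctions

variable {S V W : Set (Euc 3)} {r q : Euc 3 → ℝ}

namespace IsLocalDefiningFunction

/-- `q` is Lipschitz and vanishes at a zero of `r` whose distance from `x` is `O(|r x|)`. -/
theorem exists_eventually_abs_le (hr : IsLocalDefiningFunction S V r)
    (hq : IsLocalDefiningFunction S W q) {p : Euc 3} (hpV : p ∈ V) (hpW : p ∈ W) (hp : r p = 0) :
    ∃ C, 0 ≤ C ∧ ∀ᶠ x in 𝓝 p, |q x| ≤ C * |r x| := by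
  obtain ⟨C, hC, hproj⟩ := exists_zero_norm_sub_le (hr.contDiffAt (n := 1) hpV)
    (hr.fderiv_ne_zero hpV hp) hp
  obtain ⟨K, hK, δ, hδ, hL⟩ := (hq.contDiffAt (n := 1) hpW).exists_eventually_norm_sub_le
  refine ⟨K * C, by positivity, ?_⟩
  filter_upwards [hproj _ (inter_mem (inter_mem (hr.isOpen.mem_nhds hpV) (hq.isOpen.mem_nhds hpW))
    (Metric.ball_mem_nhds p hδ)), Metric.ball_mem_nhds p hδ] with x ⟨y, ⟨⟨hyV, hyW⟩, hyδ⟩, hy, hxy⟩ hx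
  have hqy : q y = 0 := (hq.eq_zero_iff hyW).2 ((hr.eq_zero_iff hyV).1 hy)
  have := hL x hx y hyδ
  rw [hqy, sub_zero, Real.norm_eq_abs] at this
  calc _ ≤ K * ‖x - y‖ := this
    _ ≤ K * (C * |r x|) := by gcongr
    _ = _ := by ring

/-- Along the line `y + t v` one has `r = o(t)`, hence `q = o(t)` by `|q| ≤ C |r|`. -/
theorem fderiv_apply_eq_zero (hr : IsLocalDefiningFunction S V r)
    (hq : IsLocalDefiningFunction S W q) {y : Euc 3} (hyV : y ∈ V) (hyW : y ∈ W) (hy : r y = 0)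
    {v : Euc 3} (hv : fderiv ℝ r y v = 0) : fderiv ℝ q y v = 0 := by
  obtain ⟨C, -, hC⟩ := hr.exists_eventually_abs_le hq hyV hyW hy
  have hqy : q y = 0 := (hq.eq_zero_iff hyW).2 ((hr.eq_zero_iff hyV).1 hy)
  have hline : HasDerivAt (fun t : ℝ => y + t • v) v 0 := by
    simpa using ((hasDerivAt_id (0 : ℝ)).smul_const v).const_add y
  have hcomp {f : Euc 3 → ℝ} (hf : DifferentiableAt ℝ f y) :
      HasDerivAt (fun t : ℝ => f (y + t • v)) (fderiv ℝ f y v) 0 := by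
    have hf' : HasFDerivAt f (fderiv ℝ f y) (y + (0 : ℝ) • v) := by simpa using hf.hasFDerivAt
    exact hf'.comp_hasDerivAt (0 : ℝ) hline
  have hr' := hcomp ((hr.contDiffAt (n := 1) hyV).differentiableAt one_ne_zero)
  have hq' := hcomp ((hq.contDiffAt (n := 1) hyW).differentiableAt one_ne_zero)
  refine hq'.unique ?_
  rw [hv] at hr'
  rw [hasDerivAt_iff_isLittleO] at hr' ⊢
  simp only [zero_smul, add_zero, hy, hqy, sub_zero, smul_zero] at hr' ⊢
  refine Asymptotics.IsBigO.trans_isLittleO ?_ hr'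
  refine Asymptotics.IsBigO.of_bound C ?_
  have htend : Tendsto (fun t : ℝ => y + t • v) (𝓝 0) (𝓝 y) := by
    simpa [ContinuousAt] using hline.continuousAt
  exact htend.eventually hC

/-- Two local defining functions of the same surface agree to first order, up to a factor. -/
theorem exists_eventually_factor (hr : IsLocalDefiningFunction S V r)
    (hq : IsLocalDefiningFunction S W q) {p : Euc 3} (hpV : p ∈ V) (hpW : p ∈ W) (hp : r p = 0) :
    ∃ C, 0 ≤ C ∧ ∀ᶠ x in 𝓝 p, ∃ a : ℝ, |q x - a * r x| ≤ C * |r x| ^ 2 ∧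
      ‖fderiv ℝ q x - a • fderiv ℝ r x‖ ≤ C * |r x| := by
  obtain ⟨C, hC, hproj⟩ := exists_zero_norm_sub_le (hr.contDiffAt (n := 1) hpV)
    (hr.fderiv_ne_zero hpV hp) hp
  have hdr : ContDiffAt ℝ 1 (fderiv ℝ r) p :=
    (hr.contDiffAt (n := 2) hpV).fderiv_right (by norm_num)
  have hdq : ContDiffAt ℝ 1 (fderiv ℝ q) p :=
    (hq.contDiffAt (n := 2) hpW).fderiv_right (by norm_num)
  obtain ⟨K, hK, δ, hδ, hL⟩ := hdr.exists_eventually_norm_sub_le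
  obtain ⟨K', hK', δ', hδ', hL'⟩ := hdq.exists_eventually_norm_sub_le
  obtain ⟨v, hv⟩ : ∃ v, fderiv ℝ r p v = 1 :=
    LinearMap.surjective (f := (fderiv ℝ r p : Euc 3 →ₗ[ℝ] ℝ))
      (fun h => hr.fderiv_ne_zero hpV hp (ContinuousLinearMap.coe_injective h)) 1
  have hvev : ∀ᶠ y in 𝓝 p, 1 / 2 ≤ fderiv ℝ r y v :=
    (hdr.continuousAt.clm_apply continuousAt_const).eventually_const_le (by simp only [hv]; norm_num)
  obtain ⟨M, hM, hMev⟩ :=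
    (hdq.continuousAt.clm_apply (continuousAt_const (y := v))).exists_eventually_norm_le
  obtain ⟨ε, hε, hball⟩ := Metric.mem_nhds_iff.1 (inter_mem (inter_mem (hr.isOpen.mem_nhds hpV)
    (hq.isOpen.mem_nhds hpW)) (inter_mem (Metric.ball_mem_nhds p hδ) (Metric.ball_mem_nhds p hδ')))
  set L := K' + 2 * M * K with hLdef
  have hL0 : 0 ≤ L := by positivity
  refine ⟨L * C ^ 2 + L * C, by positivity, ?_⟩
  filter_upwards [hproj _ (inter_mem (Metric.ball_mem_nhds p hε) (inter_mem hvev hMev)),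
    Metric.ball_mem_nhds p hε] with x ⟨y, ⟨hyε, hvy, hMy⟩, hy, hxy⟩ hx
  obtain ⟨⟨hyV, hyW⟩, hyδ, hyδ'⟩ := hball hyε
  rw [Set.mem_ofPred_eq] at hvy hMy
  -- At the nearby zero `y` the two differentials are proportional, and `v`, transverse to the
  -- surface, reads off the factor. Then `q - a r` vanishes to first order at `y`, with Lipschitz
  -- differential, and the mean value inequality gives the quadratic bound.
  set a := fderiv ℝ q y v / fderiv ℝ r y v with ha
  have hvy0 : fderiv ℝ r y v ≠ 0 := by linarith
  have haM : |a| ≤ 2 * M := by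
    rw [Real.norm_eq_abs] at hMy
    rw [ha, abs_div, abs_of_pos (show 0 < fderiv ℝ r y v by linarith), div_le_iff₀ (by linarith)]
    nlinarith
  have hprop : fderiv ℝ q y = a • fderiv ℝ r y := by
    ext w
    have h0 : fderiv ℝ q y (w - (fderiv ℝ r y w / fderiv ℝ r y v) • v) = 0 :=
      hr.fderiv_apply_eq_zero hq hyV hyW hy (by simp [hvy0])
    rw [map_sub, map_smul, sub_eq_zero] at h0
    rw [h0, ha]
    simp
    ring
  have hder {z : Euc 3} (hz : z ∈ Metric.ball p ε) :
      ‖fderiv ℝ q z - a • fderiv ℝ r z‖ ≤ L * ‖z - y‖ := by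
    obtain ⟨-, hzδ, hzδ'⟩ := hball hz
    have h1 : fderiv ℝ q z - a • fderiv ℝ r z =
        (fderiv ℝ q z - fderiv ℝ q y) - a • (fderiv ℝ r z - fderiv ℝ r y) := by
      rw [hprop]; module
    rw [h1]
    calc _ ≤ ‖fderiv ℝ q z - fderiv ℝ q y‖ + ‖a • (fderiv ℝ r z - fderiv ℝ r y)‖ := norm_sub_le _ _
      _ ≤ K' * ‖z - y‖ + 2 * M * (K * ‖z - y‖) := by
        rw [norm_smul, Real.norm_eq_abs]
        gcongr
        · exact hL' z hzδ' y hyδ'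
        · exact hL z hzδ y hyδ
      _ = _ := by rw [hLdef]; ring
  have hqy : q y = 0 := (hq.eq_zero_iff hyW).2 ((hr.eq_zero_iff hyV).1 hy)
  have hval : |q x - a * r x| ≤ L * ‖x - y‖ * ‖x - y‖ := by
    have hd {z : Euc 3} (hz : z ∈ Metric.ball p ε) : HasFDerivAt (fun z => q z - a * r z)
        (fderiv ℝ q z - a • fderiv ℝ r z) z := by
      obtain ⟨⟨hzV, hzW⟩, -⟩ := hball hz
      exact ((hq.contDiffAt (n := 1) hzW).differentiableAt one_ne_zero).hasFDerivAt.sub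
        (((hr.contDiffAt (n := 1) hzV).differentiableAt one_ne_zero).hasFDerivAt.const_mul a)
    have := ((convex_ball p ε).inter
        (convex_closedBall y ‖x - y‖)).norm_image_sub_le_of_norm_hasFDerivWithin_le
      (f := fun z => q z - a * r z) (C := L * ‖x - y‖)
      (fun z hz => (hd hz.1).hasFDerivWithinAt)
      (fun z hz => (hder hz.1).trans (by
        have := hz.2
        rw [Metric.mem_closedBall, dist_eq_norm] at this
        gcongr)) (x := y) (y := x) ⟨hyε, by simp⟩ ⟨hx, by simp [dist_eq_norm]⟩
    simpa [hy, hqy] using this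
  refine ⟨a, hval.trans ?_, (hder hx).trans ?_⟩
  · calc L * ‖x - y‖ * ‖x - y‖ ≤ L * (C * |r x|) * (C * |r x|) := by gcongr
      _ = L * C ^ 2 * |r x| ^ 2 := by ring
      _ ≤ _ := by gcongr; linarith [show 0 ≤ L * C by positivity]
  · calc L * ‖x - y‖ ≤ L * (C * |r x|) := by gcongr
      _ = L * C * |r x| := by ring
      _ ≤ _ := by gcongr; linarith [show 0 ≤ L * C ^ 2 by positivity]

/-- With `g = q / r`, `r dg = (dq - a dr) + (a - g) dr`, where both summands are `O(|r|)`; so `dg`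
is bounded. Then `r Hess g = Hess q - g Hess r - 2 dg dr` on the diagonal. Minimality, used for both
`q` and `r`, bounds the trace of each term by a multiple of `|r| + ∑ |dr(eᵢ)|`. -/
theorem isModerateAt_div (hr : IsLocalDefiningFunction S V r)
    (hrmin : ∀ x ∈ S ∩ V, meanCurvature r x = 0) (hq : IsLocalDefiningFunction S W q)
    (hqmin : ∀ x ∈ S ∩ W, meanCurvature q x = 0) {p : Euc 3} (hpV : p ∈ V) (hpW : p ∈ W) :
    IsModerateAt r p (fun x => q x / r x) := by
  by_cases hp : r p = 0
  swap
  · exact ((hq.contDiffAt (n := 2) hpW).div (hr.contDiffAt (n := 2) hpV) hp).isModerateAt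
  obtain ⟨A, hA, hAev⟩ := hr.exists_eventually_abs_le hq hpV hpW hp
  obtain ⟨B, hB, hBev⟩ := hr.exists_eventually_factor hq hpV hpW hp
  obtain ⟨T, hT, hTev⟩ := exists_abs_sum_hess_le hr hrmin hpV
  obtain ⟨T', hT', hTev'⟩ := exists_abs_sum_hess_le hq hqmin hpW
  obtain ⟨M, hM, hMev⟩ := ((hr.contDiffAt (n := 2) hpV).fderiv_right (m := 1)
    (by norm_num)).continuousAt.exists_eventually_norm_le
  set D := B + B * M with hD
  have hD0 : 0 ≤ D := by positivity
  refine ⟨A + D + (T' * (2 * A + 2 * D) + A * T + 2 * D), by positivity, ?_⟩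
  filter_upwards [hAev, hBev, hTev, hTev', hMev, hr.isOpen.mem_nhds hpV, hq.isOpen.mem_nhds hpW]
    with x hAx ⟨a, ha1, ha2⟩ hTx hTx' hMx hxV hxW hx0
  have habs := abs_pos.2 hx0
  have hrx := hr.contDiffAt (n := 2) hxV
  have hqx := hq.contDiffAt (n := 2) hxW
  have hg : ContDiffAt ℝ 2 (fun x => q x / r x) x := hqx.div hrx hx0
  set g := fun x => q x / r x with hgdef
  have hgx : g x * r x = q x := div_mul_cancel₀ _ hx0
  have hgA : |g x| ≤ A := by
    rw [hgdef]
    simp only [abs_div]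
    rwa [div_le_iff₀ habs]
  have heq : q =ᶠ[𝓝 x] fun y => g y * r y := by
    filter_upwards [hrx.continuousAt.eventually_ne hx0] with y hy
    exact (div_mul_cancel₀ _ hy).symm
  have hga : |a - g x| ≤ B * |r x| := by
    have h1 : q x - a * r x = (g x - a) * r x := by rw [← hgx]; ring
    rw [h1, abs_mul, pow_two, ← mul_assoc] at ha1
    rw [abs_sub_comm]
    exact le_of_mul_le_mul_right ha1 habs
  have hfd (v : Euc 3) : fderiv ℝ q x v = g x * fderiv ℝ r x v + r x * fderiv ℝ g x v := by
    rw [heq.fderiv_eq, fderiv_fun_mul (hg.differentiableAt (by norm_num))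
      (hrx.differentiableAt (by norm_num))]
    simp
  have hgD (v : Euc 3) : |fderiv ℝ g x v| ≤ D * ‖v‖ := by
    have h1 : r x * fderiv ℝ g x v =
        (fderiv ℝ q x - a • fderiv ℝ r x) v + (a - g x) * fderiv ℝ r x v := by
      have := hfd v
      simp only [FunLike.coe_sub, FunLike.coe_smul, Pi.sub_apply, Pi.smul_apply, smul_eq_mul]
      linarith
    have h2 : |(fderiv ℝ q x - a • fderiv ℝ r x) v| ≤ B * |r x| * ‖v‖ :=
      ((fderiv ℝ q x - a • fderiv ℝ r x).le_opNorm v).trans (by gcongr)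
    have h3 : |(a - g x) * fderiv ℝ r x v| ≤ B * |r x| * (M * ‖v‖) := by
      rw [abs_mul]
      gcongr
      exact ((fderiv ℝ r x).le_opNorm v).trans (by gcongr)
    have h4 : |r x| * |fderiv ℝ g x v| ≤ |r x| * (D * ‖v‖) := by
      rw [← abs_mul, h1]
      refine (abs_add_le _ _).trans ((add_le_add h2 h3).trans (le_of_eq ?_))
      rw [hD]; ring
    exact le_of_mul_le_mul_left h4 habs
  refine ⟨hg, hgA.trans ?_, fun v => (hgD v).trans ?_, fun e he => ?_⟩
  · have : 0 ≤ D + (T' * (2 * A + 2 * D) + A * T + 2 * D) := by positivity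
    linarith
  · gcongr
    have : 0 ≤ A + (T' * (2 * A + 2 * D) + A * T + 2 * D) := by positivity
    linarith
  · have hDe (i) : |fderiv ℝ g x (e i)| ≤ D := by
      have := hgD (e i)
      rwa [he.1 i, mul_one] at this
    have htrace : ∑ i, hess q x (e i) (e i) = g x * ∑ i, hess r x (e i) (e i) +
        r x * ∑ i, hess g x (e i) (e i) +
          2 * ∑ i, fderiv ℝ g x (e i) * fderiv ℝ r x (e i) := by
      simp only [hess_congr heq, hess_mul hg hrx, Finset.sum_add_distrib, Finset.mul_sum]
    have hTe := hTx e he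
    have hTe' := hTx' e he
    set Q := ∑ i, hess q x (e i) (e i)
    set R := ∑ i, hess r x (e i) (e i)
    set G := ∑ i, hess g x (e i) (e i)
    set s := ∑ i, |fderiv ℝ r x (e i)| with hs
    have hs0 : 0 ≤ s := by positivity
    have hcross : |∑ i, fderiv ℝ g x (e i) * fderiv ℝ r x (e i)| ≤ D * s := by
      rw [hs, Finset.mul_sum]
      refine (Finset.abs_sum_le_sum_abs _ _).trans (Finset.sum_le_sum fun i _ => ?_)
      rw [abs_mul]
      gcongr
      exact hDe i
    have hs' : ∑ i, |fderiv ℝ q x (e i)| ≤ A * s + 2 * (D * |r x|) := by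
      have h (i) : |fderiv ℝ q x (e i)| ≤ A * |fderiv ℝ r x (e i)| + D * |r x| := by
        rw [hfd]
        refine (abs_add_le _ _).trans ?_
        rw [abs_mul, abs_mul, mul_comm |r x|]
        gcongr
        exact hDe i
      rw [hs]
      simp only [Fin.sum_univ_two]
      linarith [h 0, h 1]
    have hQ : |Q| ≤ T' * (A * |r x| + (A * s + 2 * (D * |r x|))) := hTe'.trans (by gcongr)
    have hR : |g x * R| ≤ A * (T * (|r x| + s)) := by
      rw [abs_mul]; gcongr
    have h1 : G * r x = Q - g x * R - 2 * ∑ i, fderiv ℝ g x (e i) * fderiv ℝ r x (e i) := by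
      linarith
    have h2 : |G| * |r x| ≤ |Q| + |g x * R| +
        2 * |∑ i, fderiv ℝ g x (e i) * fderiv ℝ r x (e i)| := by
      rw [← abs_mul, h1]
      refine (abs_sub _ _).trans ?_
      rw [abs_mul 2, abs_two]
      gcongr
      exact abs_sub _ _
    have n1 : 0 ≤ (A + D) * (|r x| + s) := by positivity
    have n2 : 0 ≤ T' * A * (|r x| + s) := by positivity
    have n3 : 0 ≤ T' * D * s := by positivity
    have n4 : 0 ≤ D * |r x| := by positivity
    linarith

end IsLocalDefiningFunction

end QuotientsOfDefiningFunctions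

/-! ### Gluing squares of local defining functions. -/

section GlobalDefiningFunction

theorem IsLocalDefiningFunction.mono {S V W : Set (Euc 3)} {r : Euc 3 → ℝ}
    (h : IsLocalDefiningFunction S V r) (hW : IsOpen W) (hWV : W ⊆ V) :
    IsLocalDefiningFunction S W r where
  isOpen := hW
  smooth := h.smooth.mono hWV
  zeroSet := by
    ext x
    constructor
    · exact fun hx => ⟨hx.2, (h.eq_zero_iff (hWV hx.2)).2 hx.1⟩
    · exact fun hx => ⟨(h.eq_zero_iff (hWV hx.1)).1 hx.2, hx.1⟩
  gradient_ne_zero x hx := h.gradient_ne_zero x ⟨hx.1, hWV hx.2⟩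

/-- Every point of `U` has a neighbourhood with a bounded defining function of the minimal surface
`S`; off `S` this is the constant `1`. -/
theorem IsEmbeddedMinimalSurface.exists_bounded_defining {S U : Set (Euc 3)}
    (hS : IsEmbeddedMinimalSurface S) (hUS : IsOpen (U \ S)) {p : Euc 3} (hp : p ∈ U) :
    ∃ (V : Set (Euc 3)) (r : Euc 3 → ℝ), p ∈ V ∧ IsLocalDefiningFunction S V r ∧
      (∀ x ∈ S ∩ V, meanCurvature r x = 0) ∧ ∀ x ∈ V, |r x| ≤ 1 := by
  by_cases hpS : p ∈ S
  · obtain ⟨V, r, hpV, hr, hmin⟩ := hS p hpS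
    have hbd : ∀ᶠ x in 𝓝 p, |r x| ≤ 1 := by
      refine (hr.contDiffAt (n := 0) hpV).continuousAt.abs.eventually_le_const ?_
      simp [(hr.eq_zero_iff hpV).2 hpS]
    obtain ⟨W, hW, hWo, hpW⟩ := mem_nhds_iff.1 (inter_mem (hr.isOpen.mem_nhds hpV) hbd)
    exact ⟨W, r, hpW, hr.mono hWo fun x hx => (hW hx).1,
      fun x hx => hmin x ⟨hx.1, (hW hx.2).1⟩, fun x hx => (hW hx).2⟩
  · refine ⟨U \ S, fun _ => 1, ⟨hp, hpS⟩, ⟨hUS, contDiffOn_const, ?_, ?_⟩, ?_, by simp⟩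
    · ext x; simp
    · exact fun x hx => absurd hx.1 hx.2.2
    · exact fun x hx => absurd hx.1 hx.2.2

/-- A global nonnegative function vanishing to second order exactly on `S`, such that the traces of
the Hessian of `-log h` on planes are locally bounded below. -/
theorem IsEmbeddedMinimalSurface.exists_sq_defining {S U D : Set (Euc 3)}
    (hS : IsEmbeddedMinimalSurface S) (hUS : IsOpen (U \ S)) (hDU : closure D ⊆ U) :
    ∃ h : Euc 3 → ℝ, (∀ x ∈ D, ContDiffAt ℝ ∞ h x) ∧ (∀ x ∈ D, x ∉ S → 0 < h x) ∧
      (∀ x ∈ D, h x ≤ 1) ∧ (∀ x ∈ D, x ∈ S → h x = 0) ∧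
      ∀ p ∈ D, ∃ M, ∀ᶠ x in 𝓝 p, x ∉ S → ∀ e : Fin 2 → Euc 3, Orthonormal ℝ e →
        -M ≤ ∑ i, hess (fun y => -Real.log (h y)) x (e i) (e i) := by
  choose V r hpV hr hmin hbd using
    fun p : closure D => hS.exists_bounded_defining hUS (hDU p.2)
  obtain ⟨f, hf⟩ := SmoothPartitionOfUnity.exists_isSubordinate (modelWithCornersSelf ℝ (Euc 3))
    isClosed_closure V (fun p => (hr p).isOpen)
    (fun p hp => Set.mem_iUnion.2 ⟨⟨p, hp⟩, hpV ⟨p, hp⟩⟩)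
  have hfs (i) : ContDiff ℝ ∞ (f i) := (f i).contMDiff.contDiff
  have hfV {i : closure D} {x : Euc 3} (hx : x ∈ tsupport (f i)) : x ∈ V i := hf i hx
  have hfpos {i : closure D} {x : Euc 3} (hx : 0 < f i x) : x ∈ V i :=
    hfV (subset_tsupport _ hx.ne')
  -- Squaring removes the sign ambiguity of the `r i`, so nothing cancels and `S` need not be
  -- oriented.
  let h : Euc 3 → ℝ := fun x => ∑ i ∈ f.finsupport x, f i x * r i x ^ 2
  have hrep (p : Euc 3) : ∀ᶠ x in 𝓝 p, h x = ∑ i ∈ f.fintsupport p, f i x * r i x ^ 2 := by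
    filter_upwards [f.eventually_finsupport_subset p] with x hx
    refine Finset.sum_subset hx fun i _ hi => ?_
    rw [f.mem_finsupport, Function.mem_support, not_not] at hi
    rw [hi, zero_mul]
  refine ⟨h, fun x hx => ?_, fun x hx hxS => ?_, fun x hx => ?_, fun x hx hxS => ?_, fun p hp => ?_⟩
  · refine ContDiffAt.congr_of_eventuallyEq ?_ (hrep x)
    refine ContDiffAt.sum fun i hi => (hfs i).contDiffAt.mul (ContDiffAt.pow ?_ 2)
    exact (hr i).smooth.contDiffAt
      ((hr i).isOpen.mem_nhds (hfV ((f.mem_fintsupport_iff x i).1 hi)))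
  · obtain ⟨j, hj⟩ := f.exists_pos_of_mem (subset_closure hx)
    have hrj : r j x ≠ 0 := fun h0 => hxS (((hr j).eq_zero_iff (hfpos hj)).1 h0)
    refine Finset.sum_pos' (fun i _ => mul_nonneg (f.nonneg i x) (sq_nonneg _))
      ⟨j, (f.mem_finsupport x).2 hj.ne', by positivity⟩
  · rw [← f.sum_finsupport x (subset_closure hx)]
    refine Finset.sum_le_sum fun i hi => ?_
    have hi' : f i x ≠ 0 := (f.mem_finsupport x).1 hi
    have h1 := hbd i x (hfV (subset_tsupport _ hi'))
    exact mul_le_of_le_one_right (f.nonneg i x) ((sq_le_one_iff_abs_le_one _).2 h1)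
  · refine Finset.sum_eq_zero fun i hi => ?_
    have hi' : f i x ≠ 0 := (f.mem_finsupport x).1 hi
    rw [((hr i).eq_zero_iff (hfV (subset_tsupport _ hi'))).2 hxS]
    simp
  · obtain ⟨j, hj⟩ := f.exists_pos_of_mem (subset_closure hp)
    set T := f.fintsupport p
    have hTV {i} (hi : i ∈ T) : p ∈ V i := hfV ((f.mem_fintsupport_iff p i).1 hi)
    have hjT : j ∈ T := (f.mem_fintsupport_iff p j).2 (subset_tsupport _ hj.ne')
    -- Off `S` and near `p`, `h = (r j)² g`. The `j`-th quotient is `1`, so `g ≥ f j`, which stays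
    -- above `f j p / 2`.
    let g : Euc 3 → ℝ := fun x => ∑ i ∈ T, f i x * (r i x / r j x * (r i x / r j x))
    have hg : IsModerateAt (r j) p g := by
      refine IsModerateAt.sum T fun i hi => ?_
      have hq := (hr j).isModerateAt_div (hmin j) (hr i) (hmin i) (hTV hjT) (hTV hi)
      exact ((hfs i).contDiffAt.of_le (WithTop.coe_le_coe.2 (le_top : (2 : ℕ∞) ≤ ⊤))).isModerateAt.mul (hq.mul hq)
    have hgc : ∀ᶠ x in 𝓝 p, r j x ≠ 0 → f j p / 2 ≤ g x := by
      filter_upwards [(hfs j).continuous.continuousAt.eventually_const_le (half_lt_self hj)]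
        with x hx hrx
      refine hx.trans ?_
      refine le_trans (by simp [hrx]) (Finset.single_le_sum
        (f := fun i => f i x * (r i x / r j x * (r i x / r j x)))
        (fun i _ => mul_nonneg (f.nonneg i x) (mul_self_nonneg _)) hjT)
    obtain ⟨M, hM⟩ := hg.exists_le_sum_hess_neg_log ((hr j).contDiffAt (n := 2) (hTV hjT))
      (half_pos hj) hgc (exists_abs_sum_hess_le (hr j) (hmin j) (hTV hjT))
    refine ⟨M, ?_⟩
    filter_upwards [hM, (hrep p).eventually_nhds, (hr j).isOpen.mem_nhds (hTV hjT)]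
      with x hx hxrep hxV hxS e he
    have hrx : r j x ≠ 0 := fun h0 => hxS (((hr j).eq_zero_iff hxV).1 h0)
    have heq : (fun y => -Real.log (h y)) =ᶠ[𝓝 x] fun y => -Real.log (r j y ^ 2 * g y) := by
      filter_upwards [hxrep, ((hr j).contDiffAt (n := 0) hxV).continuousAt.eventually_ne hrx]
        with y hy hry
      rw [hy]
      congr 2
      simp only [g, Finset.mul_sum]
      refine Finset.sum_congr rfl fun i _ => ?_
      field_simp
    simp only [hess_congr heq]
    exact hx hrx e he

end GlobalDefiningFunction

/-! ### Construction of the exhaustion function. -/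

section Exhaustion

/-- A smooth convex function, nonnegative on `[0, ∞)`, with prescribed lower bounds for its
derivative on the intervals `[n + 1, n + 2]`. -/
theorem exists_smooth_convex_deriv_ge (b : ℕ → ℝ) :
    ∃ χ : ℝ → ℝ, ContDiff ℝ ∞ χ ∧ (∀ t, 0 ≤ deriv (deriv χ) t) ∧ (∀ t, 0 ≤ t → 0 ≤ χ t) ∧
      ∀ (n : ℕ) (t : ℝ), n + 1 ≤ t → b n ≤ deriv χ t := by
  -- The `n`-th summand is `0` for `t ≤ n` and `|b n|` for `t ≥ n + 1`, so the sum is locally finite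
  -- and monotone. Its primitive is `χ`.
  let β : ℝ → ℝ := fun t => ∑ n ∈ Finset.range ⌈t⌉₊, |b n| * Real.smoothTransition (t - n)
  have hβ {t : ℝ} {N : ℕ} (ht : t ≤ N) :
      β t = ∑ n ∈ Finset.range N, |b n| * Real.smoothTransition (t - n) := by
    refine Finset.sum_subset (Finset.range_mono (Nat.ceil_le.2 ht)) fun n _ hn => ?_
    rw [Finset.mem_range, not_lt] at hn
    rw [Real.smoothTransition.zero_of_nonpos (sub_nonpos.2 (Nat.ceil_le.1 hn)), mul_zero]
  have hsmooth : ContDiff ℝ ∞ β := by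
    rw [contDiff_iff_contDiffAt]
    intro t
    obtain ⟨N, hN⟩ := exists_nat_gt t
    have hev : β =ᶠ[𝓝 t] fun s => ∑ n ∈ Finset.range N, |b n| * Real.smoothTransition (s - n) := by
      filter_upwards [Iio_mem_nhds hN] with s hs
      exact hβ (le_of_lt hs)
    refine ContDiffAt.congr_of_eventuallyEq ?_ hev
    refine ContDiffAt.sum fun n _ => contDiffAt_const.mul ?_
    exact (Real.smoothTransition.contDiff (n := ⊤)).contDiffAt.comp t
      (contDiffAt_id.sub contDiffAt_const)
  have hmono : Monotone β := by
    intro s t hst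
    obtain ⟨N, hN⟩ := exists_nat_ge t
    rw [hβ hN, hβ (hst.trans hN)]
    refine Finset.sum_le_sum fun n _ => ?_
    gcongr
    exact Real.smoothTransition.monotone (by linarith)
  have hnonneg (t : ℝ) : 0 ≤ β t :=
    Finset.sum_nonneg fun n _ => mul_nonneg (abs_nonneg _) (Real.smoothTransition.nonneg _)
  have hderiv : deriv (fun t => ∫ s in (0 : ℝ)..t, β s) = β := by
    ext t
    exact hsmooth.continuous.deriv_integral _ _ _
  refine ⟨fun t => ∫ s in (0 : ℝ)..t, β s, ?_, ?_, ?_, ?_⟩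
  · rw [contDiff_infty_iff_deriv, hderiv]
    exact ⟨fun t => (hsmooth.continuous.integral_hasStrictDerivAt 0 t).hasDerivAt.differentiableAt,
      hsmooth⟩
  · rw [hderiv]
    exact fun t => hmono.deriv_nonneg
  · exact fun t ht => intervalIntegral.integral_nonneg ht fun s _ => hnonneg s
  · intro n t ht
    rw [hderiv]
    have hn : n ∈ Finset.range ⌈t⌉₊ := by
      rw [Finset.mem_range, Nat.lt_ceil]
      linarith
    refine le_trans ?_ (Finset.single_le_sum
      (f := fun n => |b n| * Real.smoothTransition (t - n))
      (fun n _ => mul_nonneg (abs_nonneg _) (Real.smoothTransition.nonneg _)) hn)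
    rw [Real.smoothTransition.one_of_one_le (by linarith), mul_one]
    exact le_abs_self _

theorem isCompact_setOf_orthonormal_pair :
    IsCompact {e : Fin 2 → Euc 3 | Orthonormal ℝ e} := by
  refine Metric.isCompact_of_isClosed_isBounded ?_ ?_
  · simp_rw [orthonormal_iff_ite, Set.ofPred_forall]
    refine isClosed_iInter fun i => isClosed_iInter fun j => ?_
    exact isClosed_eq (by fun_prop) continuous_const
  · refine (Metric.isBounded_closedBall (x := (0 : Fin 2 → Euc 3)) (r := 1)).subset fun e he => ?_
    rw [mem_closedBall_zero_iff, pi_norm_le_iff_of_nonneg zero_le_one]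
    exact fun i => (he.1 i).le

/-- Positivity on each plane is uniform because orthonormal pairs form a compact set; continuity of
the Hessian then extends it to a neighbourhood. -/
theorem exists_pos_eventually_le_sum_hess {ρ : Euc 3 → ℝ} {p : Euc 3} (hρ : ContDiffAt ℝ 2 ρ p)
    (hpos : ∀ e : Fin 2 → Euc 3, Orthonormal ℝ e → 0 < ∑ i, hess ρ p (e i) (e i)) :
    ∃ c > 0, ∀ᶠ x in 𝓝 p, ∀ e : Fin 2 → Euc 3, Orthonormal ℝ e →
      c ≤ ∑ i, hess ρ x (e i) (e i) := by
  have hne : {e : Fin 2 → Euc 3 | Orthonormal ℝ e}.Nonempty :=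
    ⟨_, (EuclideanSpace.basisFun (Fin 3) ℝ).orthonormal.comp Fin.castSucc
      (Fin.castSucc_injective 2)⟩
  have hcont : Continuous fun e : Fin 2 → Euc 3 => ∑ i, hess ρ p (e i) (e i) := by
    unfold hess
    fun_prop
  obtain ⟨e₀, he₀, hmin⟩ :=
    isCompact_setOf_orthonormal_pair.exists_isMinOn hne hcont.continuousOn
  set m := ∑ i, hess ρ p (e₀ i) (e₀ i) with hm
  have hmpos : 0 < m := hpos e₀ he₀
  have hd1 : ContDiffAt ℝ 1 (fderiv ℝ ρ) p := hρ.fderiv_right (by norm_num)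
  have hd2 : ContDiffAt ℝ 0 (fderiv ℝ (fderiv ℝ ρ)) p := hd1.fderiv_right (by norm_num)
  refine ⟨m / 2, half_pos hmpos, ?_⟩
  filter_upwards [Metric.tendsto_nhds.1 hd2.continuousAt (m / 4) (by positivity)] with x hx e he
  have h1 : m ≤ ∑ i, hess ρ p (e i) (e i) := hmin he
  rw [dist_eq_norm] at hx
  have h2 (i) : hess ρ p (e i) (e i) - m / 4 ≤ hess ρ x (e i) (e i) := by
    have h3 := (fderiv ℝ (fderiv ℝ ρ) x - fderiv ℝ (fderiv ℝ ρ) p).le_opNorm₂ (e i) (e i)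
    rw [he.1 i, mul_one, mul_one, Real.norm_eq_abs] at h3
    have h4 : (fderiv ℝ (fderiv ℝ ρ) x - fderiv ℝ (fderiv ℝ ρ) p) (e i) (e i) =
      hess ρ x (e i) (e i) - hess ρ p (e i) (e i) := rfl
    rw [h4] at h3
    linarith [(abs_le.1 h3).1]
  rw [Fin.sum_univ_two] at h1 ⊢
  linarith [h2 0, h2 1]

theorem mem_connectedComponentIn_of_mem_closure {X : Type*} [TopologicalSpace X] {A : Set X}
    {x y : X} (hx : x ∈ A) (hy : y ∈ A) (hyc : y ∈ closure (connectedComponentIn A x)) :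
    y ∈ connectedComponentIn A x := by
  have hpre : IsPreconnected (insert y (connectedComponentIn A x)) :=
    isPreconnected_connectedComponentIn.subset_closure (Set.subset_insert _ _)
      (Set.insert_subset hyc subset_closure)
  exact hpre.subset_connectedComponentIn (Set.mem_insert_of_mem _ (mem_connectedComponentIn hx))
    (Set.insert_subset hy (connectedComponentIn_subset A x)) (Set.mem_insert _ _)

theorem exists_mul_sum_hess_add_pos {D S K : Set (Euc 3)} {ρ u : Euc 3 → ℝ} (hD : IsOpen D)
    (hρ : StronglyPlurisubharmonicOn 2 ρ D) (hK : IsCompact K) (hKD : K ⊆ D)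
    (hu : ∀ p ∈ D, ∃ M, ∀ᶠ x in 𝓝 p, x ∉ S → ∀ e : Fin 2 → Euc 3, Orthonormal ℝ e →
      -M ≤ ∑ i, hess u x (e i) (e i)) :
    ∃ b : ℝ, ∀ x ∈ K, x ∉ S → ∀ e : Fin 2 → Euc 3, Orthonormal ℝ e →
      0 < b * ∑ i, hess ρ x (e i) (e i) + ∑ i, hess u x (e i) (e i) := by
  -- The condition `x ∈ D` is repeated because the sets met in the compactness induction may leave
  -- `D`. On a union the larger `b` works, the traces of `ρ` being positive.
  suffices h : ∃ b : ℝ, ∀ x ∈ K, x ∈ D → x ∉ S → ∀ e : Fin 2 → Euc 3, Orthonormal ℝ e →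
      0 < b * ∑ i, hess ρ x (e i) (e i) + ∑ i, hess u x (e i) (e i) by
    obtain ⟨b, hb⟩ := h
    exact ⟨b, fun x hx => hb x hx (hKD hx)⟩
  refine hK.induction_on (p := fun K => ∃ b : ℝ, ∀ x ∈ K, x ∈ D → x ∉ S →
    ∀ e : Fin 2 → Euc 3, Orthonormal ℝ e →
      0 < b * ∑ i, hess ρ x (e i) (e i) + ∑ i, hess u x (e i) (e i)) ?_ ?_ ?_ ?_
  · exact ⟨0, by simp⟩
  · rintro s t hst ⟨b, hb⟩
    exact ⟨b, fun x hx => hb x (hst hx)⟩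
  · rintro s t ⟨b, hb⟩ ⟨b', hb'⟩
    refine ⟨max b b', fun x hx hxD hxS e he => ?_⟩
    have hpos := hρ.2 x hxD e he
    rcases hx with hx | hx
    · have := mul_le_mul_of_nonneg_right (le_max_left b b') hpos.le
      linarith [hb x hx hxD hxS e he]
    · have := mul_le_mul_of_nonneg_right (le_max_right b b') hpos.le
      linarith [hb' x hx hxD hxS e he]
  · intro p hp
    obtain ⟨M, hM⟩ := hu p (hKD hp)
    obtain ⟨c, hc, hcev⟩ := exists_pos_eventually_le_sum_hess
      (hρ.1.contDiffAt (hD.mem_nhds (hKD hp))) (hρ.2 p (hKD hp))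
    refine ⟨_, mem_nhdsWithin_of_mem_nhds (hM.and hcev), (|M| + 1) / c,
      fun x hx hxD hxS e he => ?_⟩
    have h1 := hx.1 hxS e he
    have h2 := mul_le_mul_of_nonneg_left (hx.2 e he) (show 0 ≤ (|M| + 1) / c by positivity)
    rw [div_mul_cancel₀ _ hc.ne'] at h2
    linarith [le_abs_self M]

theorem IsExhaustionOn.exists_lower_bound {D : Set (Euc 3)} {ρ : Euc 3 → ℝ}
    (hρ : IsExhaustionOn ρ D) (hcont : ContinuousOn ρ D) : ∃ m, ∀ x ∈ D, m ≤ ρ x := by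
  rcases D.eq_empty_or_nonempty with rfl | ⟨x₀, hx₀⟩
  · exact ⟨0, by simp⟩
  · obtain ⟨y, hy, hmin⟩ := (hρ (ρ x₀)).exists_isMinOn ⟨x₀, hx₀, le_rfl⟩
      (hcont.mono fun x hx => hx.1)
    refine ⟨ρ y, fun x hx => ?_⟩
    by_cases hle : ρ x ≤ ρ x₀
    · exact hmin ⟨hx, hle⟩
    · exact hy.2.trans (not_le.1 hle).le

/-- On each sublevel set of `ρ`, a large multiple of the Hessian of `ρ` beats that of `-log h`; `ψ'`
is made at least that multiple. Sublevel sets of the sum lie in those of `ρ` and stay away from `S`.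
-/
theorem minimallyConvex_component {D U S : Set (Euc 3)} (hD : MinimallyConvex D)
    (hDU : closure D ⊆ U) (hS : IsEmbeddedMinimalSurface S) (hUS : IsOpen (U \ S))
    {C : Set (Euc 3)} (hC : IsComponentOf C (D \ S)) : MinimallyConvex C := by
  obtain ⟨hDo, -, ρ, hρs, hρp, hρe⟩ := hD
  obtain ⟨x₀, hx₀, rfl⟩ := hC
  obtain ⟨h, hh, hh0, hh1, hhS, hhlog⟩ := hS.exists_sq_defining hUS hDU
  have hDSo : IsOpen (D \ S) := by
    have : D \ S = D ∩ (U \ S) := by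
      ext x
      exact ⟨fun hx => ⟨hx.1, hDU (subset_closure hx.1), hx.2⟩, fun hx => ⟨hx.1, hx.2.2⟩⟩
    rw [this]
    exact hDo.inter hUS
  have hCsub := connectedComponentIn_subset (D \ S) x₀
  obtain ⟨m, hm⟩ := hρe.exists_lower_bound hρs.continuousOn
  choose b hb using fun n : ℕ => exists_mul_sum_hess_add_pos hDo hρp (hρe (n + 1 + m))
    (fun x hx => hx.1) hhlog
  obtain ⟨χ, hχs, hχ2, hχ0, hχb⟩ := exists_smooth_convex_deriv_ge b
  -- The summand `t` gives `ψ(ρ) ≥ ρ`, as `χ ≥ 0` there. The shift by `1 - m` puts the argument of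
  -- `χ` in `[1, ∞)`; on `[n + 1, n + 2)` one has `ρ ≤ n + 1 + m`, the set on which `b n` was
  -- chosen.
  let ψ : ℝ → ℝ := fun t => t + χ (t + (1 - m))
  have hψs : ContDiff ℝ ∞ ψ := contDiff_id.add (hχs.comp (contDiff_id.add contDiff_const))
  have hχd : Differentiable ℝ χ := hχs.differentiable (by simp)
  have hψ1 : deriv ψ = fun t => 1 + deriv χ (t + (1 - m)) := by
    ext t
    simp only [ψ]
    rw [deriv_fun_add differentiableAt_fun_id (by fun_prop), deriv_comp_add_const]
    simp
  have hψ2 (t : ℝ) : 0 ≤ deriv (deriv ψ) t := by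
    rw [hψ1, deriv_const_add, deriv_comp_add_const]
    exact hχ2 _
  have hρat {x} (hx : x ∈ D) : ContDiffAt ℝ ∞ ρ x := hρs.contDiffAt (hDo.mem_nhds hx)
  have hat {x} (hx : x ∈ D \ S) : ContDiffAt ℝ ∞ (fun y => ψ (ρ y) + -Real.log (h y)) x :=
    (hψs.contDiffAt.comp x (hρat hx.1)).add ((hh x hx.1).log (hh0 x hx.1 hx.2).ne').neg
  have h2 : (2 : WithTop ℕ∞) ≤ ∞ := WithTop.coe_le_coe.2 (le_top : (2 : ℕ∞) ≤ ⊤)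
  have hlower {x} (hx : x ∈ D \ S) :
      ρ x ≤ ψ (ρ x) + -Real.log (h x) ∧ m - Real.log (h x) ≤ ψ (ρ x) + -Real.log (h x) := by
    have := hχ0 (ρ x + (1 - m)) (by linarith [hm x hx.1])
    have hl := Real.log_nonpos (hh0 x hx.1 hx.2).le (hh1 x hx.1)
    have := hm x hx.1
    simp only [ψ]
    constructor <;> linarith
  refine ⟨hDSo.connectedComponentIn, isConnected_connectedComponentIn_iff.2 hx₀,
    fun y => ψ (ρ y) + -Real.log (h y), fun x hx => (hat (hCsub hx)).contDiffWithinAt,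
    ⟨fun x hx => ((hat (hCsub hx)).of_le h2).contDiffWithinAt, fun x hx e he => ?_⟩, fun c => ?_⟩
  · have hxD := (hCsub hx).1
    have hρx := (hρat hxD).of_le h2
    have hψx : ContDiffAt ℝ 2 ψ (ρ x) := hψs.contDiffAt.of_le h2
    have hadd (v : Euc 3) := hess_add (u := fun y => ψ (ρ y)) (v := fun y => -Real.log (h y))
      (hψx.comp x hρx) (((hh x hxD).log (hh0 x hxD (hCsub hx).2).ne').neg.of_le h2) v v
    simp only [hadd, hess_comp hψx hρx, Finset.sum_add_distrib, ← Finset.mul_sum]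
    have ht : 1 ≤ ρ x + (1 - m) := by linarith [hm x hxD]
    obtain ⟨n, hn⟩ : ∃ n, ⌊ρ x + (1 - m)⌋₊ = n + 1 :=
      Nat.exists_eq_succ_of_ne_zero (Nat.floor_pos.2 ht).ne'
    have hfl := Nat.floor_le (zero_le_one.trans ht)
    have hlt := Nat.lt_floor_add_one (ρ x + (1 - m))
    rw [hn] at hfl hlt
    push_cast at hfl hlt
    have hpos := hρp.2 x hxD e he
    have h3 := hb n x ⟨hxD, by linarith⟩ (hCsub hx).2 e he
    have h4 := mul_le_mul_of_nonneg_right (hχb n _ hfl) hpos.le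
    have h5 : 0 ≤ deriv (deriv ψ) (ρ x) * ∑ i, fderiv ℝ ρ x (e i) ^ 2 :=
      mul_nonneg (hψ2 _) (by positivity)
    have h6 : deriv ψ (ρ x) = 1 + deriv χ (ρ x + (1 - m)) := congrFun hψ1 _
    rw [h6]
    linarith
  · have hsub : {x | x ∈ connectedComponentIn (D \ S) x₀ ∧ ψ (ρ x) + -Real.log (h x) ≤ c} ⊆
        {x | x ∈ D ∧ ρ x ≤ c} :=
      fun x hx => ⟨(hCsub hx.1).1, (hlower (hCsub hx.1)).1.trans hx.2⟩
    refine (hρe c).of_isClosed_subset ?_ hsub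
    refine isClosed_of_closure_subset fun y hy => ?_
    have hyK : y ∈ {x | x ∈ D ∧ ρ x ≤ c} :=
      closure_minimal hsub (hρe c).isClosed hy
    obtain ⟨a, ha, hay⟩ := mem_closure_iff_seq_limit.1 hy
    have hyS : y ∉ S := by
      intro hyS
      have hlim := (hh y hyK.1).continuousAt.tendsto.comp hay
      rw [hhS y hyK.1 hyS] at hlim
      -- On the sublevel set `-log h ≤ c - m`, so `h ≥ exp (m - c)`, which excludes a limit point on
      -- `S`, where `h = 0`.
      have : Real.exp (m - c) ≤ 0 := by
        refine ge_of_tendsto' hlim fun n => ?_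
        have h3 := hCsub (ha n).1
        rw [Function.comp_apply, ← Real.le_log_iff_exp_le (hh0 _ h3.1 h3.2)]
        linarith [(hlower h3).2, (ha n).2]
      exact absurd (Real.exp_pos (m - c)) this.not_gt
    have hyDS : y ∈ D \ S := ⟨hyK.1, hyS⟩
    refine ⟨mem_connectedComponentIn_of_mem_closure hx₀ hyDS
      (closure_mono (fun x hx => hx.1) hy), ?_⟩
    exact le_of_tendsto' ((hat hyDS).continuousAt.tendsto.comp hay) fun n => (ha n).2

theorem minimallyConvex_univ : MinimallyConvex (Set.univ : Set (Euc 3)) := by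
  have hs : ContDiff ℝ ∞ fun x : Euc 3 => ‖x‖ ^ 2 := contDiff_norm_sq ℝ
  refine ⟨isOpen_univ, isConnected_univ, fun x => ‖x‖ ^ 2, hs.contDiffOn,
    ⟨(contDiff_norm_sq ℝ).contDiffOn, fun x _ e he => ?_⟩, fun c => ?_⟩
  · have hhess (v : Euc 3) : hess (fun x : Euc 3 => ‖x‖ ^ 2) x v v = 2 * ‖v‖ ^ 2 := by
      unfold hess
      have : fderiv ℝ (fun x : Euc 3 => ‖x‖ ^ 2) = fun x => (2 : ℝ) • innerSL ℝ x := by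
        ext y w
        simp [fderiv_norm_sq_apply]
      rw [this]
      have h2 : HasFDerivAt (fun x : Euc 3 => (2 : ℝ) • innerSL ℝ x) ((2 : ℝ) • innerSL ℝ) x :=
        ((2 : ℝ) • innerSL ℝ : Euc 3 →L[ℝ] Euc 3 →L[ℝ] ℝ).hasFDerivAt
      rw [h2.fderiv]
      simp only [FunLike.coe_smul, Pi.smul_apply, smul_eq_mul]
      exact congrArg (2 * ·) (real_inner_self_eq_norm_sq v)
    simp [hhess, he.1]
  · refine (isCompact_closedBall (0 : Euc 3) (Real.sqrt c)).of_isClosed_subset ?_ fun x hx => ?_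
    · simpa using isClosed_le hs.continuous continuous_const
    · rw [mem_closedBall_zero_iff]
      exact Real.le_sqrt_of_sq_le hx.2

end Exhaustion

theorem corollary1p3 :
    -- the complement of a properly embedded minimal surface in `ℝ³`
    (∀ S : Set (Euc 3), IsEmbeddedMinimalSurface S → IsClosed S →
      ∀ C : Set (Euc 3), IsComponentOf C Sᶜ → MinimallyConvex C) ∧
    -- an embedded minimal surface, closed in a neighborhood `U` of the closure of `D`
    (∀ D : Set (Euc 3), MinimallyConvex D →
      ∀ U : Set (Euc 3), IsOpen U → closure D ⊆ U →
      ∀ S : Set (Euc 3), IsEmbeddedMinimalSurface S → S ⊆ U →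
        IsClosed ((fun x : U => (x : Euc 3)) ⁻¹' S) →
      ∀ C : Set (Euc 3), IsComponentOf C (D \ S) → MinimallyConvex C) := by
  refine ⟨fun S hS hSc C hC => ?_, fun D hD U hU hDU S hS _ hSc C hC => ?_⟩
  · rw [Set.compl_eq_univ_sdiff] at hC
    exact minimallyConvex_component minimallyConvex_univ (Set.subset_univ _) hS
      (by rw [← Set.compl_eq_univ_sdiff]; exact hSc.isOpen_compl) hC
  · refine minimallyConvex_component hD hDU hS ?_ hC
    -- As `U` is open, the relatively open set `U \ S` is open in `ℝ³`.
    have := hU.isOpenMap_subtype_val _ hSc.isOpen_compl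
    rwa [← Set.preimage_compl, Subtype.image_preimage_coe, ← Set.sdiff_eq] at this
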